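/- **Setting.** An election consists of a nonempty finite set $V$ of $n$ voters, a nonempty finite set $C$ of candidates, and, for each voter $v$, a strict total order $\succ_v$ on $C$. Let $s_{i\succ j}$ be the fraction of voters with $i\succ_v j$, with the convention $s_{j\succ j}=\tfrac12$, and extend it bilinearly to $s_{D\succ E}$ for probability distributions $D,E$ on $C$ (a candidate is identified with the point mass on it). For nonempty multisets $A,B$ of candidates let $\Pr[A\succ_v B]=\frac{n_A(x)}{n_A(x)+n_B(x)}$, where $x$ is the most preferred candidate of $v$ occurring in $A$ or $B$ and $n_A,n_B$ are multiplicities; $D^k$ is the multiset of $k$ independent samples from $D$, and $\Pr_{v\sim V}[D^k\succ_v E]$, $\Pr_{v\sim V}[E\succ_v D^k]$ denote the expectations over the samples, averaged over the voters. A *Maximal Lottery* is a distribution $D$ such that $(D,D)$ is a Nash equilibrium of the game in which Alice and Bob choose distributions $D_A,D_B$ and receive $s_{D_A\succ D_B}$ and $s_{D_B\succ D_A}$. A *Stable $k$-Lottery* is Alice's strategy in a Nash equilibrium of the game with payoffs $\Pr_{v\sim V}[D_A^k\succ_v D_B]$ and $\Pr_{v\sim V}[D_B\succ_v D_A^k]$.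 An *$\varepsilon$-RepApx Maximal Lottery* is a distribution $D$ whose support is contained in that of some Maximal Lottery and that satisfies $s_{a\succ D}\le\frac12+\varepsilon$ for all $a\in C$. An *$\varepsilon$-RepApx Stable $k$-Lottery* is a distribution $D$ whose support is contained in that of some Stable $k$-Lottery and that satisfies $\Pr_{v\sim V}[a\succ_v D^k]\le\frac1{k+1}+\varepsilon$ for all $a\in C$. An *$(\varepsilon,k,\theta)$-RepApx Pruned Lottery*, where $\theta\in(\frac12,1]$, is obtained as follows: form the directed graph on $C$ with an edge from $a$ to $b\neq a$ whenever $s_{a\succ b}\ge\theta$; take a quasi-kernel $S$ of it (an independent set from which every vertex outside $S$ is reachable by a directed path with at most two edges); return an $\varepsilon$-RepApx Stable $k$-Lottery of the election restricted to the candidates in $S$. A (randomized) voting rule assigns to every election a probability distribution on its candidates. Its *metric distortion* is the least $\alpha\ge1$ such that, for every election and every pseudometric $d$ on $V\sqcup C$ consistent with it (i.e. $i\succ_v j$ implies $d(i,v)\le d(j,v)$), the expected social cost of the selected candidate is at most $\alpha$ times the social cost of any candidate, where $\mathrm{SC}(i)=\frac1n\sum_{v\in V}d(i,v)$. **Theorem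 (Mixing Theorem).** There exist $\mu,\tilde\beta,\varepsilon_1,\varepsilon_2\in(0,1)$ with $\frac12+\tilde\beta\le1$ and $k\in\mathbb N^+$ such that the following randomized voting rule is well defined (in every election the required lotteries exist) and achieves metric distortion strictly less than $3$: with probability $\mu$, run an $\varepsilon_1^2$-RepApx Maximal Lottery; with probability $1-\mu$, run an $(\varepsilon_2,k,\frac12+\tilde\beta)$-RepApx Pruned Lottery. Precisely, there is a constant $c<3$ such that every voting rule of this form, however the lotteries and quasi-kernels are chosen, has metric distortion at most $c$. Moreover, for every integer $k\ge7$, with $L_k=\frac{\ln(k/4)}{k}$, the choices $$\tilde\beta=\frac{L_k}{9},\qquad \varepsilon_1=\frac{L_k^3}{150000},\qquad \varepsilon_2=\frac1k,\qquad \mu=1-\frac{L_k^2}{2000}$$ satisfy all these requirements (with $c$ depending only on $k$). -/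

import Mathlib

/-- A preference profile: every voter has a strict total order on the candidates;
`P.prefers v i j` means that voter `v` prefers candidate `i` to candidate `j`. -/
structure PreferenceProfile (V : Type*) (C : Type*) where
  prefers : V → C → C → Prop
  strictTotal : ∀ v, IsStrictTotalOrder C (prefers v)

namespace PreferenceProfile

/-- The profile induced on a set of remaining candidates. -/
def restrict {V C : Type*} (P : PreferenceProfile V C) (S : Finset C) :
    PreferenceProfile V {c : C // c ∈ S} where
  prefers v i j := P.prefers v i.1 j.1
  strictTotal v :=
    letI := P.strictTotal v
    { trichotomous := fun i j h₁ h₂ =>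
        Subtype.ext (Std.Trichotomous.trichotomous (r := P.prefers v) i.1 j.1 h₁ h₂)
      irrefl := fun i => irrefl_of (P.prefers v) i.1
      trans := fun _ _ _ h₁ h₂ => trans_of (P.prefers v) h₁ h₂ }

open Classical in
/-- The contribution of voter `v` to the comparison of `i` with `j`: `1` if `i` is preferred to `j`,
`0` if `j` is preferred to `i`, and by convention `1/2` if `i = j`. -/
noncomputable def voterPref {V C : Type*} (P : PreferenceProfile V C) (v : V) (i j : C) : ℝ :=
  if i = j then 1 / 2 else if P.prefers v i j then 1 else 0

/-- `s_{i ≻ j}`: the fraction of voters who prefer `i` to `j` (`1/2` if `i = j`). -/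
noncomputable def share {V C : Type*} [Fintype V] (P : PreferenceProfile V C) (i j : C) : ℝ :=
  (Fintype.card V : ℝ)⁻¹ * ∑ v, P.voterPref v i j

/-- `s_{i ≻ D}` for a candidate `i` and a distribution `D` over the candidates. -/
noncomputable def shareVsLottery {V C : Type*} [Fintype V] [Fintype C]
    (P : PreferenceProfile V C) (i : C) (D : stdSimplex ℝ C) : ℝ :=
  (Fintype.card V : ℝ)⁻¹ * ∑ v, ∑ j, D j * P.voterPref v i j

/-- `s_{D ≻ E}` for two distributions over the candidates. -/
noncomputable def lotteryShare {V C : Type*} [Fintype V] [Fintype C]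
    (P : PreferenceProfile V C) (D E : stdSimplex ℝ C) : ℝ :=
  (Fintype.card V : ℝ)⁻¹ * ∑ v, ∑ i, ∑ j, D i * E j * P.voterPref v i j

open Classical in
/-- `Pr[A ≻_v B]` for multisets `A`, `B` of candidates: `n_A(x) / (n_A(x) + n_B(x))`, where `x` is
the most preferred candidate of voter `v` that occurs in `A` or `B`. If `A` or `B` is nonempty, exactly one
`x` satisfies the condition under the sum. -/
noncomputable def multisetPref {V C : Type*} [Fintype C] (P : PreferenceProfile V C) (v : V)
    (A B : Multiset C) : ℝ :=
  ∑ x : C, if x ∈ A + B ∧ ∀ y ∈ A + B, y ≠ x → P.prefers v x y then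
    (A.count x : ℝ) / ((A.count x : ℝ) + (B.count x : ℝ)) else 0

end PreferenceProfile

/-- The multiset of the values of a `k`-tuple of candidates. -/
def sampleMultiset {C : Type*} {k : ℕ} (s : Fin k → C) : Multiset C :=
  Finset.univ.val.map s

namespace PreferenceProfile

/-- `Pr_v[D^k ≻_v b]`: probability that the multiset of `k` independent samples from `D`
beats the single candidate `b`, averaged over the voters. -/
noncomputable def sampleBeats {V C : Type*} [Fintype V] [Fintype C] (P : PreferenceProfile V C)
    (k : ℕ) (D : stdSimplex ℝ C) (b : C) : ℝ :=
  (Fintype.card V : ℝ)⁻¹ * ∑ v, ∑ s : Fin k → C,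
    (∏ t, D (s t)) * P.multisetPref v (sampleMultiset s) {b}

/-- `Pr_v[b ≻_v D^k]`. -/
noncomputable def beatsSample {V C : Type*} [Fintype V] [Fintype C] (P : PreferenceProfile V C)
    (k : ℕ) (b : C) (D : stdSimplex ℝ C) : ℝ :=
  (Fintype.card V : ℝ)⁻¹ * ∑ v, ∑ s : Fin k → C,
    (∏ t, D (s t)) * P.multisetPref v {b} (sampleMultiset s)

end PreferenceProfile

/-- Pure-strategy Nash equilibria of a two-player game with payoff functions `uA` (of the player
who chooses in `S`) and `uB` (of the player who chooses in `T`). -/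
def IsNashEquilibrium {S T : Type*} (uA uB : S → T → ℝ) (a : S) (b : T) : Prop :=
  (∀ a', uA a' b ≤ uA a b) ∧ (∀ b', uB a b' ≤ uB a b)

namespace PreferenceProfile

/-- `D` is a Maximal Lottery: `(D, D)` is a Nash equilibrium of the Condorcet game. -/
def IsMaximalLottery {V C : Type*} [Fintype V] [Fintype C] (P : PreferenceProfile V C)
    (D : stdSimplex ℝ C) : Prop :=
  IsNashEquilibrium (fun DA DB => P.lotteryShare DA DB) (fun DA DB => P.lotteryShare DB DA) D D

/-- `D` is a Stable `k`-Lottery: Alice's strategy in a Nash equilibrium of the `k`-vs-`1`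
Condorcet game. -/
def IsStableLottery {V C : Type*} [Fintype V] [Fintype C] (P : PreferenceProfile V C) (k : ℕ)
    (D : stdSimplex ℝ C) : Prop :=
  ∃ E : stdSimplex ℝ C, IsNashEquilibrium
    (fun DA DB : stdSimplex ℝ C => ∑ b, DB b * P.sampleBeats k DA b)
    (fun DA DB : stdSimplex ℝ C => ∑ b, DB b * P.beatsSample k b DA) D E

/-- `ε`-Representative Approximate Maximal Lotteries. -/
def IsRepApxMaximalLottery {V C : Type*} [Fintype V] [Fintype C] (P : PreferenceProfile V C)
    (ε : ℝ) (D : stdSimplex ℝ C) : Prop :=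
  (∃ D₀, P.IsMaximalLottery D₀ ∧ ∀ c, 0 < D c → 0 < D₀ c) ∧
    ∀ a, P.shareVsLottery a D ≤ 1 / 2 + ε

/-- `ε`-Representative Approximate Stable `k`-Lotteries. -/
def IsRepApxStableLottery {V C : Type*} [Fintype V] [Fintype C] (P : PreferenceProfile V C)
    (ε : ℝ) (k : ℕ) (D : stdSimplex ℝ C) : Prop :=
  (∃ D₀, P.IsStableLottery k D₀ ∧ ∀ c, 0 < D c → 0 < D₀ c) ∧
    ∀ a, P.beatsSample k a D ≤ 1 / ((k : ℝ) + 1) + ε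

end PreferenceProfile

/-- A quasi-kernel of a directed graph: an independent set from which every other vertex can be
reached by a directed path with at most two edges. -/
def Digraph.IsQuasiKernel {C : Type*} (G : Digraph C) (S : Finset C) : Prop :=
  (∀ u ∈ S, ∀ w ∈ S, u ≠ w → ¬ G.Adj u w) ∧
    ∀ v ∉ S, ∃ u ∈ S, G.Adj u v ∨ ∃ w, G.Adj u w ∧ G.Adj w v

namespace PreferenceProfile

/-- The directed graph on the candidates with an edge from `a` to `b ≠ a` iff `s_{a ≻ b} ≥ θ`. -/
def thresholdGraph {V C : Type*} [Fintype V] (P : PreferenceProfile V C) (θ : ℝ) : Digraph C where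
  Adj a b := a ≠ b ∧ θ ≤ P.share a b

/-- `D` is a possible output of the `(ε, k, θ)`-RepApx Pruned Lotteries: compute a quasi-kernel `S`
of the threshold graph and return an `ε`-RepApx Stable `k`-Lottery of the election restricted
to `S` (viewed as a distribution over all candidates). -/
def IsRepApxPrunedLottery {V C : Type*} [Fintype V] [Fintype C] (P : PreferenceProfile V C)
    (ε : ℝ) (k : ℕ) (θ : ℝ) (D : stdSimplex ℝ C) : Prop :=
  ∃ S : Finset C, (P.thresholdGraph θ).IsQuasiKernel S ∧
    ∃ E : stdSimplex ℝ {c : C // c ∈ S}, (P.restrict S).IsRepApxStableLottery ε k E ∧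
      (∀ c : {c : C // c ∈ S}, D c.1 = E c) ∧ ∀ c ∉ S, D c = 0

end PreferenceProfile

universe u v

/-- A (randomized) voting rule assigns to every election, with a nonempty finite set of voters and a
nonempty finite set of candidates, a probability distribution over the candidates. -/
def VotingRule : Type (max (u + 1) (v + 1)) :=
  ∀ (V : Type u) (C : Type v) [Fintype V] [Nonempty V] [Fintype C] [Nonempty C],
    PreferenceProfile V C → stdSimplex ℝ C

/-- The social cost of candidate `i` under a pseudometric on voters and candidates. -/
noncomputable def socialCost {V C : Type*} [Fintype V] (d : PseudoMetricSpace (V ⊕ C)) (i : C) :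
    ℝ :=
  (Fintype.card V : ℝ)⁻¹ * ∑ v : V, d.dist (Sum.inr i) (Sum.inl v)

/-- The profile is consistent with the pseudometric. -/
def PreferenceProfile.IsConsistent {V C : Type*} (P : PreferenceProfile V C)
    (d : PseudoMetricSpace (V ⊕ C)) : Prop :=
  ∀ v i j, P.prefers v i j → d.dist (Sum.inr i) (Sum.inl v) ≤ d.dist (Sum.inr j) (Sum.inl v)

/-- In every election and for every consistent pseudometric, the expected social cost of the
candidate selected by `f` is at most `α` times the social cost of any candidate. -/
def VotingRule.DistortionAtMost (f : VotingRule.{u, v}) (α : ℝ) : Prop :=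
  ∀ (V : Type u) (C : Type v) [Fintype V] [Nonempty V] [Fintype C] [Nonempty C]
    (P : PreferenceProfile V C) (d : PseudoMetricSpace (V ⊕ C)), P.IsConsistent d →
      ∀ j : C, ∑ i, f V C P i * socialCost d i ≤ α * socialCost d j

/-- The metric distortion of `f`: the least real `α ≥ 1` such that `f` has distortion at most `α`
(`⊤` if there is none). -/
noncomputable def VotingRule.metricDistortion (f : VotingRule.{u, v}) : EReal :=
  sInf {x : EReal | ∃ α : ℝ, 1 ≤ α ∧ f.DistortionAtMost α ∧ x = (α : EReal)}

/-- `f` runs, in every election, some `ε₁²`-RepApx Maximal Lottery with probability `μ`, and some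
`(ε₂, k, 1/2 + β)`-RepApx Pruned Lottery with probability `1 - μ`. -/
def VotingRule.IsMixingRule (μ β ε₁ ε₂ : ℝ) (k : ℕ) (f : VotingRule.{u, v}) : Prop :=
  ∀ (V : Type u) (C : Type v) [Fintype V] [Nonempty V] [Fintype C] [Nonempty C]
    (P : PreferenceProfile V C), ∃ D₁ D₂ : stdSimplex ℝ C,
      P.IsRepApxMaximalLottery (ε₁ ^ 2) D₁ ∧ P.IsRepApxPrunedLottery ε₂ k (1 / 2 + β) D₂ ∧
        ∀ c, f V C P c = μ * D₁ c + (1 - μ) * D₂ c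

/-! Fix a candidate `j` of cost `S`. For a Maximal Lottery `D`, the tail Pr[d(i,v) - d(j,v) > t],
with `i` drawn from `D` and `v` a random voter, is at most the tail Pr[2d(j,v) > t]; integrating
over `t` gives cost at most 3`S`. The first tail also never exceeds 1/2. So if 2d(j,v) > t holds for
a 1/2 + τ fraction of voters at every t < t₀, the bound improves by τt₀. Approximation adds an error
proportional to the integration range, which is at most 8`S` because members of the support of a
Maximal Lottery lie that close to `j` (`IsMaximalLottery.dist_le`).

Hence, if this lottery is nearly as bad as 3, almost half of the voters lie within a small distance
h of `j` (`IsRepApxMaximalLottery.costTail_lt`). Every edge of the threshold graph is then supported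
by such a voter, so the quasi-kernel contains some `u` within 4h of `j`. Near voters prefer `u` to
all candidates farther than 6h from `j`, so stability keeps the probability p of selecting a far
candidate away from 1. Independence of the quasi-kernel keeps far candidates at cost little above
3`S`, while the others cost at most `S` + 6h. So the pruned lottery is strictly better than 3
(`maximal_or_pruned_cost_le`).

The pruned lottery always has bounded distortion, so giving it a sufficiently small weight keeps the
mixture below 3 in both cases (`exists_mixing_bound`). Existence of the lotteries comes from Sion's
minimax theorem and the Chvátal–Lovász theorem. -/

/-! ### Averages over voters -/

/-- The average of a real-valued function over the voters. -/
noncomputable def voterAvg {V : Type*} [Fintype V] (f : V → ℝ) : ℝ :=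
  (Fintype.card V : ℝ)⁻¹ * ∑ v, f v

section VoterAvg

variable {V : Type*} [Fintype V]

theorem voterAvg_add (f g : V → ℝ) :
    voterAvg (fun v => f v + g v) = voterAvg f + voterAvg g := by
  simp [voterAvg, Finset.sum_add_distrib, mul_add]

theorem voterAvg_sub (f g : V → ℝ) :
    voterAvg (fun v => f v - g v) = voterAvg f - voterAvg g := by
  simp [voterAvg, Finset.sum_sub_distrib, mul_sub]

theorem voterAvg_const_mul (c : ℝ) (f : V → ℝ) :
    voterAvg (fun v => c * f v) = c * voterAvg f := by
  simp only [voterAvg, ← Finset.mul_sum]; ring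

theorem voterAvg_mul_const (f : V → ℝ) (c : ℝ) :
    voterAvg (fun v => f v * c) = voterAvg f * c := by
  simp only [voterAvg, ← Finset.sum_mul]; ring

theorem voterAvg_sum {ι : Type*} (s : Finset ι) (f : ι → V → ℝ) :
    voterAvg (fun v => ∑ i ∈ s, f i v) = ∑ i ∈ s, voterAvg (f i) := by
  simp only [voterAvg, Finset.mul_sum]; exact Finset.sum_comm

theorem voterAvg_mono {f g : V → ℝ} (h : ∀ v, f v ≤ g v) : voterAvg f ≤ voterAvg g :=
  mul_le_mul_of_nonneg_left (Finset.sum_le_sum fun v _ => h v) (by positivity)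

theorem voterAvg_nonneg {f : V → ℝ} (h : ∀ v, 0 ≤ f v) : 0 ≤ voterAvg f :=
  mul_nonneg (by positivity) (Finset.sum_nonneg fun v _ => h v)

@[simp] theorem voterAvg_const [Nonempty V] (c : ℝ) : voterAvg (fun _ : V => c) = c := by
  have : (Fintype.card V : ℝ) ≠ 0 := by exact_mod_cast Fintype.card_ne_zero
  simp [voterAvg]

theorem exists_of_voterAvg_lt {f g : V → ℝ} (h : voterAvg f < voterAvg g) : ∃ v, f v < g v := by
  by_contra! H
  exact absurd (voterAvg_mono H) (not_le.2 h)

end VoterAvg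

/-! ### Pairwise comparisons and shares -/

namespace PreferenceProfile

variable {V C : Type*} (P : PreferenceProfile V C)

theorem prefers_trans {v : V} {a b c : C} (h₁ : P.prefers v a b) (h₂ : P.prefers v b c) :
    P.prefers v a c :=
  let := P.strictTotal v
  trans_of (P.prefers v) h₁ h₂

theorem not_prefers_self (v : V) (a : C) : ¬ P.prefers v a a :=
  let := P.strictTotal v
  irrefl_of (P.prefers v) a

theorem prefers_asymm {v : V} {a b : C} (h : P.prefers v a b) : ¬ P.prefers v b a :=
  fun h' => P.not_prefers_self v a (P.prefers_trans h h')

theorem prefers_or_of_ne (v : V) {a b : C} (h : a ≠ b) : P.prefers v a b ∨ P.prefers v b a := by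
  let := P.strictTotal v
  by_contra! H
  exact h (Std.Trichotomous.trichotomous (r := P.prefers v) a b H.1 H.2)

@[simp] theorem voterPref_self (v : V) (a : C) : P.voterPref v a a = 1 / 2 := by
  simp [voterPref]

theorem voterPref_of_prefers {v : V} {a b : C} (h : P.prefers v a b) : P.voterPref v a b = 1 := by
  have : a ≠ b := by rintro rfl; exact P.not_prefers_self v a h
  simp [voterPref, this, h]

theorem voterPref_of_prefers_swap {v : V} {a b : C} (h : P.prefers v b a) :
    P.voterPref v a b = 0 := by
  have : a ≠ b := by rintro rfl; exact P.not_prefers_self v a h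
  simp [voterPref, this, P.prefers_asymm h]

theorem voterPref_cases (v : V) (a b : C) :
    (a = b ∧ P.voterPref v a b = 1 / 2 ∧ P.voterPref v b a = 1 / 2) ∨
    (P.prefers v a b ∧ P.voterPref v a b = 1 ∧ P.voterPref v b a = 0) ∨
    (P.prefers v b a ∧ P.voterPref v a b = 0 ∧ P.voterPref v b a = 1) := by
  by_cases h : a = b
  · subst h; simp
  · rcases P.prefers_or_of_ne v h with h | h
    · exact .inr (.inl ⟨h, P.voterPref_of_prefers h, P.voterPref_of_prefers_swap h⟩)
    · exact .inr (.inr ⟨h, P.voterPref_of_prefers_swap h, P.voterPref_of_prefers h⟩)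

theorem voterPref_add_swap (v : V) (a b : C) : P.voterPref v a b + P.voterPref v b a = 1 := by
  rcases P.voterPref_cases v a b with ⟨-, h, h'⟩ | ⟨-, h, h'⟩ | ⟨-, h, h'⟩ <;> rw [h, h'] <;> norm_num

theorem voterPref_nonneg (v : V) (a b : C) : 0 ≤ P.voterPref v a b := by
  rcases P.voterPref_cases v a b with ⟨-, h, -⟩ | ⟨-, h, -⟩ | ⟨-, h, -⟩ <;> rw [h] <;> norm_num

theorem voterPref_le_one (v : V) (a b : C) : P.voterPref v a b ≤ 1 := by
  linarith [P.voterPref_add_swap v a b, P.voterPref_nonneg v b a]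

variable [Fintype V]

theorem share_eq_voterAvg (a b : C) : P.share a b = voterAvg fun v => P.voterPref v a b := rfl

theorem share_add_swap [Nonempty V] (a b : C) : P.share a b + P.share b a = 1 := by
  simp [share_eq_voterAvg, ← voterAvg_add, voterPref_add_swap]

theorem share_nonneg (a b : C) : 0 ≤ P.share a b :=
  voterAvg_nonneg fun v => P.voterPref_nonneg v a b

theorem share_le_one [Nonempty V] (a b : C) : P.share a b ≤ 1 := by
  linarith [P.share_add_swap a b, P.share_nonneg b a]

variable [Fintype C]

theorem shareVsLottery_eq_sum (a : C) (D : stdSimplex ℝ C) :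
    P.shareVsLottery a D = ∑ b, D b * P.share a b := by
  change voterAvg (fun v => ∑ b, D b * P.voterPref v a b) = _
  rw [voterAvg_sum]
  simp_rw [voterAvg_const_mul, share_eq_voterAvg]

theorem lotteryShare_eq_sum (D E : stdSimplex ℝ C) :
    P.lotteryShare D E = ∑ a, D a * P.shareVsLottery a E := by
  change voterAvg (fun v => ∑ a, ∑ b, D a * E b * P.voterPref v a b) = _
  rw [voterAvg_sum]
  refine Finset.sum_congr rfl fun a _ => ?_
  rw [voterAvg_sum, shareVsLottery_eq_sum, Finset.mul_sum]
  refine Finset.sum_congr rfl fun b _ => ?_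
  rw [voterAvg_const_mul, share_eq_voterAvg, mul_assoc]

theorem lotteryShare_eq_sum_sum (D E : stdSimplex ℝ C) :
    P.lotteryShare D E = ∑ a, ∑ b, D a * E b * P.share a b := by
  simp_rw [lotteryShare_eq_sum, shareVsLottery_eq_sum, Finset.mul_sum, mul_assoc]

theorem lotteryShare_add_swap [Nonempty V] (D E : stdSimplex ℝ C) :
    P.lotteryShare D E + P.lotteryShare E D = 1 := by
  rw [lotteryShare_eq_sum_sum, lotteryShare_eq_sum_sum, Finset.sum_comm (f := fun a b => E a * D b * _),
    ← Finset.sum_add_distrib]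
  calc _ = ∑ a, ∑ b, D a * E b := by
        refine Finset.sum_congr rfl fun a _ => ?_
        rw [← Finset.sum_add_distrib]
        refine Finset.sum_congr rfl fun b _ => ?_
        linear_combination D a * E b * P.share_add_swap a b
    _ = 1 := by simp [← Finset.mul_sum, stdSimplex.sum_eq_one]

theorem lotteryShare_self [Nonempty V] (D : stdSimplex ℝ C) : P.lotteryShare D D = 1 / 2 := by
  linarith [P.lotteryShare_add_swap D D]

end PreferenceProfile

/-! ### Maximal lotteries: support and existence -/

open Classical in
/-- The lottery that always selects the candidate `a`. -/
noncomputable def pointLottery {C : Type*} [Fintype C] (a : C) : stdSimplex ℝ C :=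
  ⟨Pi.single a 1, single_mem_stdSimplex ℝ a⟩

open Classical in
theorem sum_pointLottery_mul {C : Type*} [Fintype C] (a : C) (f : C → ℝ) :
    ∑ c, pointLottery a c * f c = f a := by
  have h : ∀ c, pointLottery a c = (Pi.single a 1 : C → ℝ) c := fun _ => rfl
  simp [h, Pi.single_apply]

namespace PreferenceProfile

variable {V C : Type*} (P : PreferenceProfile V C) [Fintype V] [Fintype C]

theorem lotteryShare_pointLottery (a : C) (E : stdSimplex ℝ C) :
    P.lotteryShare (pointLottery a) E = P.shareVsLottery a E := by
  rw [lotteryShare_eq_sum, sum_pointLottery_mul]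

theorem IsMaximalLottery.shareVsLottery_le [Nonempty V] {D : stdSimplex ℝ C}
    (hD : P.IsMaximalLottery D) (a : C) : P.shareVsLottery a D ≤ 1 / 2 := by
  have := hD.1 (pointLottery a)
  simpa [lotteryShare_pointLottery, lotteryShare_self] using this

/-- Complementary slackness: the `D`-average of these shares is 1/2 and none exceeds 1/2. -/
theorem IsMaximalLottery.shareVsLottery_eq [Nonempty V] {D : stdSimplex ℝ C}
    (hD : P.IsMaximalLottery D) {a : C} (ha : 0 < D a) : P.shareVsLottery a D = 1 / 2 := by
  have h0 : ∑ c, D c * (1 / 2 - P.shareVsLottery c D) = 0 := by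
    simp only [mul_sub, Finset.sum_sub_distrib, ← lotteryShare_eq_sum, lotteryShare_self,
      ← Finset.sum_mul, stdSimplex.sum_eq_one]
    norm_num
  have h1 := (Finset.sum_eq_zero_iff_of_nonneg (fun c _ => mul_nonneg (stdSimplex.zero_le D c)
    (sub_nonneg.2 (hD.shareVsLottery_le P c)))).1 h0 a (Finset.mem_univ a)
  rcases mul_eq_zero.1 h1 with h | h <;> linarith

theorem exists_isMaximalLottery [Nonempty V] [Nonempty C] :
    ∃ D : stdSimplex ℝ C, P.IsMaximalLottery D := by
  let f : (C → ℝ) → (C → ℝ) → ℝ := fun x y => ∑ a, ∑ b, y a * x b * P.share a b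
  have hne : (stdSimplex ℝ C).Nonempty := ⟨_, (pointLottery (Classical.arbitrary C)).2⟩
  have hl : ∀ y, IsLinearMap ℝ fun x => f x y := fun y =>
    { map_add := fun a b => by simp [f, mul_add, add_mul, Finset.sum_add_distrib]
      map_smul := fun c a => by
        simp only [f, Pi.smul_apply, smul_eq_mul, Finset.mul_sum]
        exact Finset.sum_congr rfl fun _ _ => Finset.sum_congr rfl fun _ _ => by ring }
  have hr : ∀ x, IsLinearMap ℝ fun y => f x y := fun x =>
    { map_add := fun a b => by simp [f, add_mul, Finset.sum_add_distrib]
      map_smul := fun c a => by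
        simp only [f, Pi.smul_apply, smul_eq_mul, Finset.mul_sum]
        exact Finset.sum_congr rfl fun _ _ => Finset.sum_congr rfl fun _ _ => by ring }
  have hc := convex_stdSimplex ℝ C
  obtain ⟨a, ha, b, hb, hab⟩ := Sion.exists_isSaddlePointOn (f := f) hne hc
    (isCompact_stdSimplex ℝ C)
    (fun y _ => (Continuous.continuousOn (by fun_prop)).lowerSemicontinuousOn)
    (fun y _ => (((hl y).mk' _).convexOn hc).quasiconvexOn) hc hne (isCompact_stdSimplex ℝ C)
    (fun x _ => (Continuous.continuousOn (by fun_prop)).upperSemicontinuousOn)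
    (fun x _ => (((hr x).mk' _).concaveOn hc).quasiconcaveOn)
  let D : stdSimplex ℝ C := ⟨b, hb⟩
  have hf : ∀ x y : stdSimplex ℝ C, f x y = P.lotteryShare y x := fun x y =>
    (P.lotteryShare_eq_sum_sum y x).symm
  have key : ∀ E : stdSimplex ℝ C, 1 / 2 ≤ P.lotteryShare D E := by
    intro E
    -- Testing the saddle point with the minimizer `a` in the maximizer's place gives the diagonal
    -- value 1/2, so the maximizer `b` scores at least 1/2 against everyone.
    have := hab E E.2 a ha
    have h1 := hf ⟨a, ha⟩ ⟨a, ha⟩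
    have h2 := hf E D
    rw [lotteryShare_self] at h1
    have h1' : f a a = 1 / 2 := h1
    have h2' : f E b = P.lotteryShare D E := h2
    linarith
  have : ∀ E, P.lotteryShare E D ≤ P.lotteryShare D D := fun E => by
    rw [lotteryShare_self]; linarith [key E, P.lotteryShare_add_swap D E]
  exact ⟨D, this, this⟩

end PreferenceProfile

/-! ### A candidate against a random sample -/

namespace PreferenceProfile

variable {V C : Type*} (P : PreferenceProfile V C)

theorem exists_top (v : V) {M : Multiset C} (hM : M ≠ 0) :
    ∃ x ∈ M, ∀ y ∈ M, y ≠ x → P.prefers v x y := by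
  induction M using Multiset.induction_on with
  | empty => exact absurd rfl hM
  | cons a M ih =>
    by_cases h0 : M = 0
    · exact ⟨a, by simp, by simp [h0]⟩
    obtain ⟨x, hx, hxM⟩ := ih h0
    by_cases hax : a = x
    · subst hax
      refine ⟨a, by simp, fun y hy hya => hxM y ?_ hya⟩
      exact (Multiset.mem_cons.1 hy).resolve_left hya
    rcases P.prefers_or_of_ne v hax with h | h
    · refine ⟨a, by simp, fun y hy hya => ?_⟩
      have hyM := (Multiset.mem_cons.1 hy).resolve_left hya
      by_cases hyx : y = x
      · rwa [hyx]
      · exact P.prefers_trans h (hxM y hyM hyx)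
    · refine ⟨x, by simp [hx], fun y hy hyx => ?_⟩
      rcases Multiset.mem_cons.1 hy with rfl | hy
      · exact h
      · exact hxM y hy hyx

open Classical in
theorem multisetPref_of_top [Fintype C] {v : V} {A B : Multiset C} {x : C} (hx : x ∈ A + B)
    (htop : ∀ y ∈ A + B, y ≠ x → P.prefers v x y) :
    P.multisetPref v A B = (A.count x : ℝ) / ((A.count x : ℝ) + (B.count x : ℝ)) := by
  unfold multisetPref
  rw [Finset.sum_eq_single x]
  · rw [if_pos ⟨hx, htop⟩]
  · intro y _ hyx
    refine if_neg fun h => ?_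
    exact P.prefers_asymm (htop y h.1 hyx) (h.2 x hx hyx.symm)
  · simp

open Classical in
theorem multisetPref_add_swap [Fintype C] (v : V) {A B : Multiset C} (h : A + B ≠ 0) :
    P.multisetPref v A B + P.multisetPref v B A = 1 := by
  obtain ⟨x, hx, htop⟩ := P.exists_top v h
  have h2 : B + A = A + B := add_comm _ _
  rw [P.multisetPref_of_top hx htop, P.multisetPref_of_top (x := x) (by rwa [h2]) (by rwa [h2])]
  have : 0 < (A.count x : ℝ) + B.count x := by
    exact_mod_cast Multiset.count_add x A B ▸ Multiset.count_pos.2 hx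
  rw [add_comm (Multiset.count x B : ℝ), ← add_div, div_self this.ne']

open Classical in
/-- The weight of `c` when a voter compares `b` with a sampled candidate `c`, a tie being counted
with weight `r`. -/
noncomputable def tieWeight (v : V) (b : C) (r : ℝ) (c : C) : ℝ :=
  if c = b then r else if P.prefers v b c then 1 else 0

theorem tieWeight_nonneg (v : V) (b : C) {r : ℝ} (hr : 0 ≤ r) (c : C) :
    0 ≤ P.tieWeight v b r c := by
  unfold tieWeight; split_ifs <;> simp [hr]

theorem continuous_tieWeight (v : V) (b c : C) : Continuous fun r => P.tieWeight v b r c := by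
  unfold tieWeight; split_ifs <;> fun_prop

open Classical in
theorem mem_sampleMultiset {k : ℕ} {s : Fin k → C} {c : C} :
    c ∈ sampleMultiset s ↔ ∃ t, s t = c := by
  simp [sampleMultiset]

open Classical in
theorem count_sampleMultiset {k : ℕ} (s : Fin k → C) (b : C) :
    (sampleMultiset s).count b = (Finset.univ.filter fun t => s t = b).card := by
  rw [sampleMultiset, Multiset.count_map, Finset.card_def, Finset.filter_val]
  simp only [eq_comm]

-- If `b` is on top and occurs m times in the sample, the tie rule gives 1/(m+1), the integral of
-- r^m over [0,1]. This turns the comparison into a product over the sample points, so that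
-- independence applies.
open Classical in
theorem multisetPref_singleton_sampleMultiset [Fintype C] {k : ℕ} (v : V) (b : C)
    (s : Fin k → C) :
    P.multisetPref v {b} (sampleMultiset s) = ∫ r in (0 : ℝ)..1, ∏ t, P.tieWeight v b r (s t) := by
  by_cases h : ∀ t, s t = b ∨ P.prefers v b (s t)
  · have h1 : ∀ r : ℝ, ∏ t, P.tieWeight v b r (s t) = r ^ (sampleMultiset s).count b := by
      intro r
      rw [count_sampleMultiset, ← Finset.prod_const, Finset.prod_filter]
      refine Finset.prod_congr rfl fun t _ => ?_
      unfold tieWeight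
      by_cases ht : s t = b
      · simp [ht]
      · simp [ht, (h t).resolve_left ht]
    rw [P.multisetPref_of_top (x := b) (by simp)]
    · simp_rw [h1]
      rw [integral_pow]
      simp [add_comm]
    · intro y hy hyb
      rcases Multiset.mem_add.1 hy with hy | hy
      · exact absurd (Multiset.mem_singleton.1 hy) hyb
      · obtain ⟨t, rfl⟩ := mem_sampleMultiset.1 hy
        exact (h t).resolve_left hyb
  · push Not at h
    obtain ⟨t, htb, ht⟩ := h
    have h1 : ∀ r : ℝ, ∏ t, P.tieWeight v b r (s t) = 0 := fun r =>
      Finset.prod_eq_zero (Finset.mem_univ t) (by simp [tieWeight, htb, ht])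
    simp_rw [h1]
    obtain ⟨x, hx, htop⟩ := P.exists_top v (M := {b} + sampleMultiset s) (by simp)
    have hxb : x ≠ b := by
      rintro rfl
      exact ht (htop _ (Multiset.mem_add.2 (.inr (mem_sampleMultiset.2 ⟨t, rfl⟩))) htb)
    rw [P.multisetPref_of_top hx htop]
    simp [hxb]

variable [Fintype V] [Fintype C]

theorem beatsSample_eq_integral (k : ℕ) (b : C) (D : stdSimplex ℝ C) :
    P.beatsSample k b D =
      voterAvg fun v => ∫ r in (0 : ℝ)..1, (∑ c, D c * P.tieWeight v b r c) ^ k := by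
  classical
  change voterAvg _ = _
  congr 1 with v
  have hc := fun c => P.continuous_tieWeight v b c
  simp_rw [Finset.sum_pow', Fintype.piFinset_univ, multisetPref_singleton_sampleMultiset]
  rw [intervalIntegral.integral_finsetSum fun s _ =>
    Continuous.intervalIntegrable (by fun_prop) _ _]
  simp_rw [Finset.prod_mul_distrib, intervalIntegral.integral_const_mul]

/-- In the integral formula the integrand is the `k`-th power of a nonnegative function linear in
the lottery. This is the convexity that the minimax theorem needs. -/
theorem beatsSample_convexOn (k : ℕ) (b : C) {D E F : stdSimplex ℝ C} {x y : ℝ}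
    (hx : 0 ≤ x) (hy : 0 ≤ y) (hxy : x + y = 1) (hF : ∀ c, F c = x * D c + y * E c) :
    P.beatsSample k b F ≤ x * P.beatsSample k b D + y * P.beatsSample k b E := by
  simp only [beatsSample_eq_integral, ← voterAvg_const_mul]
  rw [← voterAvg_add]
  refine voterAvg_mono fun v => ?_
  have hc := fun c => P.continuous_tieWeight v b c
  rw [← intervalIntegral.integral_const_mul, ← intervalIntegral.integral_const_mul,
    ← intervalIntegral.integral_add (Continuous.intervalIntegrable (by fun_prop) _ _)
      (Continuous.intervalIntegrable (by fun_prop) _ _)]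
  refine intervalIntegral.integral_mono_on zero_le_one
    (Continuous.intervalIntegrable (by fun_prop) _ _)
    (Continuous.intervalIntegrable (by fun_prop) _ _) fun r hr => ?_
  have hnn : ∀ D : stdSimplex ℝ C, 0 ≤ ∑ c, D c * P.tieWeight v b r c := fun D =>
    Finset.sum_nonneg fun c _ => mul_nonneg (stdSimplex.zero_le D c)
      (P.tieWeight_nonneg v b hr.1 c)
  have := (convexOn_pow (𝕜 := ℝ) k).2 (hnn D) (hnn E) hx hy hxy
  simp only [smul_eq_mul] at this
  have hsum : ∑ c, F c * P.tieWeight v b r c =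
      x * ∑ c, D c * P.tieWeight v b r c + y * ∑ c, E c * P.tieWeight v b r c := by
    rw [Finset.mul_sum, Finset.mul_sum, ← Finset.sum_add_distrib]
    exact Finset.sum_congr rfl fun c _ => by rw [hF]; ring
  rwa [hsum]

theorem sampleBeats_add_beatsSample [Nonempty V] (k : ℕ) (b : C) (D : stdSimplex ℝ C) :
    P.sampleBeats k D b + P.beatsSample k b D = 1 := by
  classical
  change voterAvg _ + voterAvg _ = 1
  rw [← voterAvg_add, ← voterAvg_const (V := V) 1]
  congr 1 with v
  rw [← Finset.sum_add_distrib]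
  simp_rw [← mul_add]
  have : ∀ s : Fin k → C, P.multisetPref v (sampleMultiset s) {b} +
      P.multisetPref v {b} (sampleMultiset s) = 1 := fun s => P.multisetPref_add_swap v (by simp)
  simp_rw [this, mul_one]
  rw [← Fintype.piFinset_univ, ← Finset.sum_pow', stdSimplex.sum_eq_one, one_pow]

end PreferenceProfile

/-! ### Value of the stable lottery game and existence of equilibria -/

theorem sum_mul_integral_pow_add_mul (k : ℕ) (F g : ℝ) :
    g * ∫ r in (0 : ℝ)..1, (F + g * r) ^ k = ((F + g) ^ (k + 1) - F ^ (k + 1)) / (k + 1) := by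
  rw [← intervalIntegral.integral_const_mul]
  have h : ∀ r ∈ Set.uIcc (0 : ℝ) 1,
      HasDerivAt (fun r => (F + g * r) ^ (k + 1) / (k + 1)) (g * (F + g * r) ^ k) r := by
    intro r _
    have h1 : HasDerivAt (fun r => F + g * r) g r := by
      simpa using ((hasDerivAt_id r).const_mul g).const_add F
    refine ((h1.pow (k + 1)).div_const ((k : ℝ) + 1)).congr_deriv ?_
    have : (k : ℝ) + 1 ≠ 0 := by positivity
    push_cast
    field_simp
  rw [intervalIntegral.integral_eq_sub_of_hasDerivAt h
    (Continuous.intervalIntegrable (by fun_prop) _ _)]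
  simp; ring

theorem sum_pow_sub_pow_telescope {C : Type*} [LinearOrder C] (x : C → ℝ) (m : ℕ) (s : Finset C) :
    ∑ c ∈ s, ((∑ b ∈ s with c < b, x b + x c) ^ (m + 1) - (∑ b ∈ s with c < b, x b) ^ (m + 1)) =
      (∑ c ∈ s, x c) ^ (m + 1) := by
  induction s using Finset.induction_on_min with
  | empty => simp
  | insert a s ha ih =>
    have has : a ∉ s := fun h => lt_irrefl _ (ha a h)
    have h1 : (insert a s).filter (a < ·) = s := by
      rw [Finset.filter_insert, if_neg (lt_irrefl a), Finset.filter_true_of_mem ha]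
    rw [Finset.sum_insert has, h1, Finset.sum_insert has]
    have h2 : ∀ c ∈ s, (insert a s).filter (c < ·) = s.filter (c < ·) := fun c hc => by
      rw [Finset.filter_insert, if_neg (ha c hc).not_gt]
    have h3 : ∀ c ∈ s, (∑ b ∈ insert a s with c < b, x b + x c) ^ (m + 1) -
        (∑ b ∈ insert a s with c < b, x b) ^ (m + 1) =
        (∑ b ∈ s with c < b, x b + x c) ^ (m + 1) - (∑ b ∈ s with c < b, x b) ^ (m + 1) :=
      fun c hc => by rw [h2 c hc]
    rw [Finset.sum_congr rfl h3, ih]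
    ring

namespace PreferenceProfile

variable {V C : Type*} (P : PreferenceProfile V C) [Fintype V] [Fintype C]

/-- A candidate drawn from a lottery beats `k` further candidates drawn from the same lottery with
probability `1 / (k + 1)`. -/
theorem sum_mul_beatsSample_self [Nonempty V] (k : ℕ) (D : stdSimplex ℝ C) :
    ∑ b, D b * P.beatsSample k b D = 1 / ((k : ℝ) + 1) := by
  classical
  simp_rw [beatsSample_eq_integral, ← voterAvg_const_mul]
  rw [← voterAvg_sum, ← voterAvg_const (V := V) (1 / ((k : ℝ) + 1))]
  congr 1 with v
  let := P.strictTotal v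
  -- With candidates ordered by `v`, smaller meaning better, the integral for `b` is a difference of
  -- powers of consecutive tail masses, and the sum over `b` telescopes.
  let : LinearOrder C := linearOrderOfSTO (P.prefers v)
  have h1 : ∀ b : C, ∀ r : ℝ, ∑ c, D c * P.tieWeight v b r c = ∑ c with b < c, D c + D b * r := by
    intro b r
    have : ∀ c, D c * P.tieWeight v b r c =
        (if b < c then D c else 0) + (if c = b then D b * r else 0) := by
      intro c
      have hlt : P.prefers v b c ↔ b < c := Iff.rfl
      unfold tieWeight
      simp only [hlt]
      by_cases hcb : c = b
      · simp [hcb]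
      · by_cases hbc : b < c <;> simp [hcb, hbc]
    simp_rw [this, Finset.sum_add_distrib, Finset.sum_filter]
    simp
  simp_rw [h1, sum_mul_integral_pow_add_mul, ← Finset.sum_div]
  rw [sum_pow_sub_pow_telescope, stdSimplex.sum_eq_one, one_pow]

theorem exists_isStableLottery [Nonempty V] [Nonempty C] (k : ℕ) :
    ∃ D : stdSimplex ℝ C, P.IsStableLottery k D ∧
      ∀ a, P.beatsSample k a D ≤ 1 / ((k : ℝ) + 1) := by
  classical
  let G : C → (C → ℝ) → ℝ := fun b x => voterAvg fun v => ∑ s : Fin k → C,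
    (∏ t, x (s t)) * P.multisetPref v {b} (sampleMultiset s)
  have hG : ∀ b (D : stdSimplex ℝ C), P.beatsSample k b D = G b D := fun _ _ => rfl
  have hGc : ∀ b, Continuous (G b) := fun b => by
    unfold G voterAvg; fun_prop
  let f : (C → ℝ) → (C → ℝ) → ℝ := fun x y => ∑ b, y b * G b x
  have hne : (stdSimplex ℝ C).Nonempty := ⟨_, (pointLottery (Classical.arbitrary C)).2⟩
  have hc := convex_stdSimplex ℝ C
  have hr : ∀ x, IsLinearMap ℝ fun y => f x y := fun x =>
    { map_add := fun a b => by simp [f, add_mul, Finset.sum_add_distrib]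
      map_smul := fun c a => by
        simp only [f, Pi.smul_apply, smul_eq_mul, Finset.mul_sum]
        exact Finset.sum_congr rfl fun _ _ => by ring }
  have hl : ∀ y ∈ stdSimplex ℝ C, ConvexOn ℝ (stdSimplex ℝ C) fun x => f x y := by
    refine fun y hy => ⟨hc, fun x₁ h₁ x₂ h₂ p q hp hq hpq => ?_⟩
    simp only [f, smul_eq_mul, Finset.mul_sum]
    rw [← Finset.sum_add_distrib]
    refine Finset.sum_le_sum fun b _ => ?_
    have := P.beatsSample_convexOn k b (D := ⟨x₁, h₁⟩) (E := ⟨x₂, h₂⟩)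
      (F := ⟨p • x₁ + q • x₂, hc h₁ h₂ hp hq hpq⟩) hp hq hpq (fun _ => rfl)
    rw [hG, hG, hG] at this
    have h := mul_le_mul_of_nonneg_left this (hy.1 b)
    calc _ ≤ _ := h
      _ = _ := by
        change y b * (p * G b x₁ + q * G b x₂) = p * (y b * G b x₁) + q * (y b * G b x₂)
        ring
  obtain ⟨a, ha, b, hb, hab⟩ := Sion.exists_isSaddlePointOn (f := f) hne hc
    (isCompact_stdSimplex ℝ C)
    (fun y _ => (Continuous.continuousOn (by unfold f; fun_prop)).lowerSemicontinuousOn)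
    (fun y hy => (hl y hy).quasiconvexOn) hc hne (isCompact_stdSimplex ℝ C)
    (fun x _ => (Continuous.continuousOn (by unfold f; fun_prop)).upperSemicontinuousOn)
    (fun x _ => (((hr x).mk' _).concaveOn hc).quasiconcaveOn)
  let D : stdSimplex ℝ C := ⟨a, ha⟩
  let E : stdSimplex ℝ C := ⟨b, hb⟩
  have hB : ∀ D' E' : stdSimplex ℝ C, ∑ c, E' c * P.beatsSample k c D' = f D' E' :=
    fun _ _ => rfl
  have hA : ∀ D' E' : stdSimplex ℝ C, ∑ c, E' c * P.sampleBeats k D' c = 1 - f D' E' := by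
    intro D' E'
    rw [← hB, ← stdSimplex.sum_eq_one E', ← Finset.sum_sub_distrib]
    refine Finset.sum_congr rfl fun c _ => ?_
    linear_combination E' c * P.sampleBeats_add_beatsSample k c D'
  refine ⟨D, ⟨E, fun D' => ?_, fun E' => ?_⟩, fun c => ?_⟩
  · change ∑ c, E c * P.sampleBeats k D' c ≤ ∑ c, E c * P.sampleBeats k D c
    rw [hA, hA]
    exact sub_le_sub_left (hab D' D'.2 b hb) _
  · change ∑ c, E' c * P.beatsSample k c D ≤ ∑ c, E c * P.beatsSample k c D
    rw [hB, hB]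
    exact hab a ha E' E'.2
  -- Alice may copy Bob's strategy `E`, which yields exactly 1/(k+1); the saddle inequality
  -- transfers this bound to `D` against any `c`.
  · rw [← P.sum_mul_beatsSample_self k E, hB, ← sum_pointLottery_mul c (P.beatsSample k · D), hB]
    exact hab b hb _ (pointLottery c).2

end PreferenceProfile

/-! ### Quasi-kernels and well-definedness of the rule -/

-- Remove a vertex `a` with its out-neighbours and recurse. If the set obtained has an edge into
-- `a`, it reaches the removed vertices through `a`; otherwise `a` can be added to it.
open Classical in
theorem Digraph.exists_isQuasiKernel_on {C : Type*} (G : Digraph C) (T : Finset C) :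
    ∃ S ⊆ T, (∀ u ∈ S, ∀ w ∈ S, u ≠ w → ¬ G.Adj u w) ∧
      ∀ v ∈ T, v ∉ S → ∃ u ∈ S, G.Adj u v ∨ ∃ w, G.Adj u w ∧ G.Adj w v := by
  induction T using Finset.strongInduction with
  | H T ih =>
    rcases T.eq_empty_or_nonempty with rfl | ⟨a, ha⟩
    · exact ⟨∅, by simp⟩
    obtain ⟨S, hST, hind, hreach⟩ := ih (T.filter fun x => x ≠ a ∧ ¬ G.Adj a x)
      (Finset.filter_ssubset.2 ⟨a, ha, by simp⟩)
    have hST' : S ⊆ T := hST.trans (Finset.filter_subset _ _)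
    have hS : ∀ x ∈ S, x ≠ a ∧ ¬ G.Adj a x := fun x hx => (Finset.mem_filter.1 (hST hx)).2
    by_cases hu : ∃ u ∈ S, G.Adj u a
    · obtain ⟨u, huS, hua⟩ := hu
      refine ⟨S, hST', hind, fun x hx hxS => ?_⟩
      by_cases hxa : x = a
      · exact ⟨u, huS, .inl (hxa ▸ hua)⟩
      by_cases hax : G.Adj a x
      · exact ⟨u, huS, .inr ⟨a, hua, hax⟩⟩
      · exact hreach x (Finset.mem_filter.2 ⟨hx, hxa, hax⟩) hxS
    · push Not at hu
      refine ⟨insert a S, Finset.insert_subset ha hST', ?_, fun x hx hxS => ?_⟩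
      · intro u hu' w hw huw
        rcases Finset.mem_insert.1 hu' with rfl | huS <;>
          rcases Finset.mem_insert.1 hw with rfl | hwS
        · exact absurd rfl huw
        · exact (hS w hwS).2
        · exact hu u huS
        · exact hind u huS w hwS huw
      · rw [Finset.mem_insert, not_or] at hxS
        by_cases hax : G.Adj a x
        · exact ⟨a, Finset.mem_insert_self _ _, .inl hax⟩
        · obtain ⟨u, hu', h⟩ := hreach x (Finset.mem_filter.2 ⟨hx, hxS.1, hax⟩) hxS.2
          exact ⟨u, Finset.mem_insert_of_mem hu', h⟩

/-- The Chvátal–Lovász theorem: every finite directed graph has a quasi-kernel. -/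
theorem Digraph.exists_isQuasiKernel {C : Type*} [Fintype C] (G : Digraph C) :
    ∃ S, G.IsQuasiKernel S := by
  obtain ⟨S, -, h₁, h₂⟩ := G.exists_isQuasiKernel_on Finset.univ
  exact ⟨S, h₁, fun v hv => h₂ v (Finset.mem_univ v) hv⟩

theorem Digraph.IsQuasiKernel.nonempty {C : Type*} [Nonempty C] {G : Digraph C} {S : Finset C}
    (h : G.IsQuasiKernel S) : S.Nonempty := by
  let a := Classical.arbitrary C
  by_cases ha : a ∈ S
  · exact ⟨a, ha⟩
  · obtain ⟨u, hu, -⟩ := h.2 a ha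
    exact ⟨u, hu⟩

open Classical in
/-- A lottery over some of the candidates, viewed as a lottery over all of them. -/
noncomputable def extendLottery {C : Type*} [Fintype C] {S : Finset C}
    (E : stdSimplex ℝ {c : C // c ∈ S}) : stdSimplex ℝ C :=
  ⟨fun c => if h : c ∈ S then E ⟨c, h⟩ else 0,
    fun c => by dsimp only; split_ifs; exacts [stdSimplex.zero_le E _, le_rfl], by
      rw [Finset.sum_dite, Finset.sum_const_zero, add_zero, ← stdSimplex.sum_eq_one E]
      refine Finset.sum_bij (fun x _ => ⟨x.1, (Finset.mem_filter.1 x.2).2⟩) (by simp) ?_ ?_ ?_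
      · intro x _ y _ h
        exact Subtype.ext (congrArg (fun z : {c : C // c ∈ S} => z.1) h)
      · intro y _
        exact ⟨⟨y.1, by simp [y.2]⟩, by simp, rfl⟩
      · intro x _
        rfl⟩

theorem extendLottery_coe {C : Type*} [Fintype C] {S : Finset C}
    (E : stdSimplex ℝ {c : C // c ∈ S}) (c : {c : C // c ∈ S}) :
    extendLottery E c.1 = E c :=
  dif_pos c.2

theorem extendLottery_of_notMem {C : Type*} [Fintype C] {S : Finset C}
    (E : stdSimplex ℝ {c : C // c ∈ S}) {c : C} (hc : c ∉ S) : extendLottery E c = 0 :=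
  dif_neg hc

namespace PreferenceProfile

variable {V C : Type*} [Fintype V] [Nonempty V] [Fintype C] [Nonempty C]
  (P : PreferenceProfile V C)

theorem exists_isRepApxMaximalLottery {ε : ℝ} (hε : 0 ≤ ε) :
    ∃ D, P.IsRepApxMaximalLottery ε D := by
  obtain ⟨D, hD⟩ := P.exists_isMaximalLottery
  exact ⟨D, ⟨D, hD, fun _ h => h⟩, fun a => by linarith [hD.shareVsLottery_le P a]⟩

theorem exists_isRepApxStableLottery (k : ℕ) {ε : ℝ} (hε : 0 ≤ ε) :
    ∃ D, P.IsRepApxStableLottery ε k D := by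
  obtain ⟨D, hD, h⟩ := P.exists_isStableLottery k
  exact ⟨D, ⟨D, hD, fun _ h => h⟩, fun a => by linarith [h a]⟩

theorem exists_isRepApxPrunedLottery (k : ℕ) (θ : ℝ) {ε : ℝ} (hε : 0 ≤ ε) :
    ∃ D, P.IsRepApxPrunedLottery ε k θ D := by
  obtain ⟨S, hS⟩ := (P.thresholdGraph θ).exists_isQuasiKernel
  have : Nonempty {c : C // c ∈ S} := hS.nonempty.to_subtype
  obtain ⟨E, hE⟩ := (P.restrict S).exists_isRepApxStableLottery k hε
  exact ⟨extendLottery E, S, hS, E, hE, extendLottery_coe E, fun c => extendLottery_of_notMem E⟩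

end PreferenceProfile

theorem exists_isMixingRule {μ β ε₁ ε₂ : ℝ} (k : ℕ) (hμ : μ ∈ Set.Icc (0 : ℝ) 1) (hε₂ : 0 ≤ ε₂) :
    ∃ f : VotingRule.{u, v}, f.IsMixingRule μ β ε₁ ε₂ k := by
  have key : ∀ (V : Type u) (C : Type v) [Fintype V] [Nonempty V] [Fintype C] [Nonempty C]
      (P : PreferenceProfile V C), ∃ D D₁ D₂ : stdSimplex ℝ C,
      P.IsRepApxMaximalLottery (ε₁ ^ 2) D₁ ∧ P.IsRepApxPrunedLottery ε₂ k (1 / 2 + β) D₂ ∧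
        ∀ c, D c = μ * D₁ c + (1 - μ) * D₂ c := by
    intro V C _ _ _ _ P
    obtain ⟨D₁, h₁⟩ := P.exists_isRepApxMaximalLottery (sq_nonneg ε₁)
    obtain ⟨D₂, h₂⟩ := P.exists_isRepApxPrunedLottery k (1 / 2 + β) hε₂
    exact ⟨⟨μ • D₁.1 + (1 - μ) • D₂.1, convex_stdSimplex ℝ C D₁.2 D₂.2 hμ.1 (sub_nonneg.2 hμ.2)
      (by ring)⟩, D₁, D₂, h₁, h₂, fun c => rfl⟩
  choose f hf using key
  exact ⟨f, hf⟩

/-! ### From tails to expectations -/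

/-- The indicator of `t < a`, as a function of `t`. -/
noncomputable def step (a t : ℝ) : ℝ := if t < a then 1 else 0

theorem step_of_lt {a t : ℝ} (h : t < a) : step a t = 1 := if_pos h

theorem step_of_le {a t : ℝ} (h : a ≤ t) : step a t = 0 := if_neg h.not_gt

theorem step_nonneg (a t : ℝ) : 0 ≤ step a t := by unfold step; split_ifs <;> norm_num

theorem step_le_one (a t : ℝ) : step a t ≤ 1 := by unfold step; split_ifs <;> norm_num

theorem intervalIntegrable_step (a b c : ℝ) :
    IntervalIntegrable (step a) MeasureTheory.volume b c := by
  refine Antitone.intervalIntegrable fun s t hst => ?_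
  unfold step
  split_ifs <;> linarith

theorem IntervalIntegrable.finsetSum_apply {ι : Type*} (s : Finset ι) {f : ι → ℝ → ℝ} {a b : ℝ}
    (h : ∀ i ∈ s, IntervalIntegrable (f i) MeasureTheory.volume a b) :
    IntervalIntegrable (fun t => ∑ i ∈ s, f i t) MeasureTheory.volume a b := by
  have hsum : (fun t => ∑ i ∈ s, f i t) = ∑ i ∈ s, f i := by ext t; simp
  rw [hsum]
  exact IntervalIntegrable.sum s h

theorem integral_step (a : ℝ) {X : ℝ} (hX : 0 ≤ X) :
    ∫ t in (0 : ℝ)..X, step a t = max 0 (min a X) := by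
  set c := max 0 (min a X) with hc
  have hc0 : 0 ≤ c := le_max_left _ _
  have hcX : c ≤ X := max_le hX (min_le_right _ _)
  rw [← intervalIntegral.integral_add_adjacent_intervals (b := c)
      (intervalIntegrable_step _ _ _) (intervalIntegrable_step _ _ _),
    intervalIntegral.integral_congr_Ioo_of_le (g := fun _ => 1) hc0,
    intervalIntegral.integral_congr_Ioo_of_le (g := fun _ => 0) hcX]
  · simp
  · intro t ht
    refine step_of_le ?_
    have := (le_max_right _ _).trans_lt ht.1
    rcases min_lt_iff.1 this with h | h
    · exact h.le
    · exact absurd ht.2 h.le.not_gt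
  · intro t ht
    refine step_of_lt ?_
    rcases lt_max_iff.1 ht.2 with h | h
    · exact absurd ht.1 h.le.not_gt
    · exact h.trans_le (min_le_left _ _)

/-- A comparison of tail probabilities on `(0, X)` yields a comparison of expectations. -/
theorem voterAvg_sum_le_of_tail_le {V C : Type*} [Fintype V] [Fintype C]
    (D : stdSimplex ℝ C) (a : V → C → ℝ) (y : V → ℝ) {X τ t₀ c : ℝ} (hX : 0 ≤ X)
    (ha : ∀ v i, 0 < D i → a v i ≤ X) (hy : ∀ v, 0 ≤ y v) (ht₀ : t₀ ≤ X) (hτ : 0 ≤ τ)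
    (h : ∀ t ∈ Set.Ioo 0 X, voterAvg (fun v => ∑ i, D i * step (a v i) t) + τ * step t₀ t ≤
      voterAvg (fun v => step (y v) t) + c) :
    voterAvg (fun v => ∑ i, D i * a v i) + τ * t₀ ≤ voterAvg y + c * X := by
  have hint := fun a : ℝ => intervalIntegrable_step a 0 X
  have hint₁ : IntervalIntegrable (fun t => ∑ v, ∑ i, D i * step (a v i) t)
      MeasureTheory.volume 0 X :=
    IntervalIntegrable.finsetSum_apply _ fun v _ => IntervalIntegrable.finsetSum_apply _ fun i _ => (hint _).const_mul _
  have hint₂ : IntervalIntegrable (fun t => ∑ v, step (y v) t) MeasureTheory.volume 0 X :=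
    IntervalIntegrable.finsetSum_apply _ fun v _ => hint _
  have key := intervalIntegral.integral_mono_on_of_le_Ioo hX
    ((hint₁.const_mul (Fintype.card V : ℝ)⁻¹).add ((hint t₀).const_mul τ))
    ((hint₂.const_mul (Fintype.card V : ℝ)⁻¹).add intervalIntegrable_const) h
  rw [intervalIntegral.integral_add (hint₁.const_mul _) ((hint t₀).const_mul τ),
    intervalIntegral.integral_add (hint₂.const_mul _) intervalIntegrable_const,
    intervalIntegral.integral_const_mul, intervalIntegral.integral_const_mul,
    intervalIntegral.integral_const_mul,
    intervalIntegral.integral_finsetSum fun v _ =>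
      IntervalIntegrable.finsetSum_apply _ fun i _ => (hint _).const_mul _,
    intervalIntegral.integral_finsetSum fun v _ => hint _] at key
  simp_rw [intervalIntegral.integral_finsetSum fun i _ => (hint _).const_mul _,
    intervalIntegral.integral_const_mul, integral_step _ hX, intervalIntegral.integral_const] at key
  -- Truncation at `X` changes nothing on the support of `D`, and truncation at 0 only increases the
  -- value.
  have h₁ : voterAvg (fun v => ∑ i, D i * a v i) ≤
      voterAvg fun v => ∑ i, D i * max 0 (min (a v i) X) := by
    refine voterAvg_mono fun v => Finset.sum_le_sum fun i _ => ?_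
    rcases (stdSimplex.zero_le D i).eq_or_lt with h0 | h0
    · simp [← h0]
    · rw [min_eq_left (ha v i h0)]
      exact mul_le_mul_of_nonneg_left (le_max_right _ _) h0.le
  have h₂ : voterAvg (fun v => max 0 (min (y v) X)) ≤ voterAvg y :=
    voterAvg_mono fun v => max_le (hy v) (min_le_left _ _)
  have h₃ : τ * t₀ ≤ τ * max 0 (min t₀ X) := by
    rw [min_eq_left ht₀]
    exact mul_le_mul_of_nonneg_left (le_max_right _ _) hτ
  have h₄ : (X - 0) • c = c * X := by simp [mul_comm]
  rw [h₄] at key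
  unfold voterAvg at *
  linarith

/-! ### Tail bounds for approximate maximal lotteries -/

namespace PreferenceProfile

variable {V C : Type*} (P : PreferenceProfile V C)

section Metric

variable {d : PseudoMetricSpace (V ⊕ C)} {P}

theorem dist_candidate_self (d : PseudoMetricSpace (V ⊕ C)) (j : C) :
    d.dist (Sum.inr j) (Sum.inr j) = 0 := d.dist_self _

theorem dist_candidate_nonneg (d : PseudoMetricSpace (V ⊕ C)) (x y : V ⊕ C) :
    0 ≤ d.dist x y := @dist_nonneg _ d x y

theorem dist_voter_le (d : PseudoMetricSpace (V ⊕ C)) (i j : C) (v : V) :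
    d.dist (Sum.inr i) (Sum.inl v) ≤
      d.dist (Sum.inr i) (Sum.inr j) + d.dist (Sum.inr j) (Sum.inl v) := d.dist_triangle _ _ _

theorem dist_candidate_le (d : PseudoMetricSpace (V ⊕ C)) (i j : C) (v : V) :
    d.dist (Sum.inr i) (Sum.inr j) ≤
      d.dist (Sum.inr i) (Sum.inl v) + d.dist (Sum.inr j) (Sum.inl v) := by
  rw [d.dist_comm (Sum.inr j)]; exact d.dist_triangle _ _ _

/-- A candidate that is much worse for a voter than `j` is less preferred than every candidate
close to `j`. -/
theorem IsConsistent.step_gain_le (hd : P.IsConsistent d) (v : V) (i j k : C) {t : ℝ}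
    (hk : d.dist (Sum.inr k) (Sum.inr j) ≤ t) :
    step (d.dist (Sum.inr i) (Sum.inl v) - d.dist (Sum.inr j) (Sum.inl v)) t ≤
      step (d.dist (Sum.inr i) (Sum.inr j)) t * P.voterPref v k i := by
  by_cases h : t < d.dist (Sum.inr i) (Sum.inl v) - d.dist (Sum.inr j) (Sum.inl v)
  · have hi : t < d.dist (Sum.inr i) (Sum.inr j) := by linarith [dist_voter_le d i j v]
    rw [step_of_lt h, step_of_lt hi]
    rcases P.voterPref_cases v k i with ⟨rfl, -⟩ | ⟨-, h, -⟩ | ⟨h', -⟩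
    · linarith
    · rw [h]; norm_num
    · linarith [hd v i k h', dist_voter_le d k j v]
  · rw [step_of_le (not_lt.1 h)]
    exact mul_nonneg (step_nonneg _ _) (P.voterPref_nonneg _ _ _)

/-- A voter who prefers to `j` a candidate far from `j` is far from `j`. -/
theorem IsConsistent.step_mul_voterPref_le (hd : P.IsConsistent d) (v : V) (i j : C) {t : ℝ}
    (ht : 0 ≤ t) :
    step (d.dist (Sum.inr i) (Sum.inr j)) t * P.voterPref v i j ≤
      step (2 * d.dist (Sum.inr j) (Sum.inl v)) t := by
  by_cases hi : t < d.dist (Sum.inr i) (Sum.inr j)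
  · rcases P.voterPref_cases v i j with ⟨rfl, -⟩ | ⟨h, h', -⟩ | ⟨-, h, -⟩
    · rw [dist_candidate_self] at hi; linarith
    · rw [h', step_of_lt hi, step_of_lt]
      · norm_num
      · linarith [hd v i j h, dist_candidate_le d i j v]
    · rw [h, mul_zero]; exact step_nonneg _ _
  · rw [step_of_le (not_lt.1 hi), zero_mul]; exact step_nonneg _ _

end Metric

theorem sum_sum_mul_share [Fintype V] [Nonempty V] [Fintype C] (w : C → ℝ) :
    ∑ i, ∑ k, w i * w k * P.share i k = (∑ i, w i) ^ 2 / 2 := by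
  have h : ∑ i, ∑ k, w i * w k * P.share i k + ∑ i, ∑ k, w i * w k * P.share i k =
      (∑ i, w i) ^ 2 := by
    nth_rewrite 2 [Finset.sum_comm]
    rw [← Finset.sum_add_distrib, sq, Finset.sum_mul_sum]
    refine Finset.sum_congr rfl fun i _ => ?_
    rw [← Finset.sum_add_distrib]
    refine Finset.sum_congr rfl fun k _ => ?_
    linear_combination w i * w k * P.share_add_swap i k
  linarith

theorem voterPref_triangle (v : V) {i j k : C} (hik : i ≠ k) :
    P.voterPref v i k + P.voterPref v k j - 1 ≤ P.voterPref v i j := by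
  rcases P.voterPref_cases v i k with ⟨h, -⟩ | ⟨h₁, h₁', -⟩ | ⟨-, h₁', -⟩
  · exact absurd h hik
  · rcases P.voterPref_cases v k j with ⟨rfl, h₂', -⟩ | ⟨h₂, h₂', -⟩ | ⟨-, h₂', -⟩
    · rw [h₁']; norm_num
    · rw [h₁', h₂', P.voterPref_of_prefers (P.prefers_trans h₁ h₂)]; norm_num
    · rw [h₁', h₂']; linarith [P.voterPref_nonneg v i j]
  · rw [h₁']; linarith [P.voterPref_nonneg v i j, P.voterPref_le_one v k j]

theorem share_triangle [Fintype V] [Nonempty V] {i j k : C} (hik : i ≠ k) :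
    P.share i k + P.share k j - 1 ≤ P.share i j := by
  simp only [share_eq_voterAvg]
  rw [← voterAvg_add, ← voterAvg_const (V := V) 1, ← voterAvg_sub]
  exact voterAvg_mono fun v => P.voterPref_triangle v hik

section Tail

variable {P} {d : PseudoMetricSpace (V ⊕ C)} [Fintype V] [Fintype C]
  {D : stdSimplex ℝ C} {ε : ℝ}

/-- Any `k` in the ball of radius `t` around `j` may serve as reference; this freedom allows
averaging over `k` later. -/
theorem IsConsistent.gainTail_le_sum (hd : P.IsConsistent d) (D : stdSimplex ℝ C) (j k : C) {t : ℝ}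
    (hk : d.dist (Sum.inr k) (Sum.inr j) ≤ t) :
    voterAvg (fun v => ∑ i, D i *
      step (d.dist (Sum.inr i) (Sum.inl v) - d.dist (Sum.inr j) (Sum.inl v)) t) ≤
      ∑ i, D i * step (d.dist (Sum.inr i) (Sum.inr j)) t * P.share k i := by
  simp_rw [share_eq_voterAvg, ← voterAvg_const_mul, ← voterAvg_sum, mul_assoc]
  refine voterAvg_mono fun v => Finset.sum_le_sum fun i _ => ?_
  exact mul_le_mul_of_nonneg_left (hd.step_gain_le v i j k hk) (stdSimplex.zero_le D i)

theorem sum_mul_one_sub_step (D : stdSimplex ℝ C) (g : C → ℝ) :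
    ∑ i, D i * (1 - g i) = 1 - ∑ i, D i * g i := by
  simp [mul_sub, stdSimplex.sum_eq_one]

theorem IsConsistent.gainTail_le_half (hd : P.IsConsistent d)
    (hD : ∀ a, P.shareVsLottery a D ≤ 1 / 2 + ε) (j : C) {t : ℝ} (ht : 0 ≤ t) :
    voterAvg (fun v => ∑ i, D i *
      step (d.dist (Sum.inr i) (Sum.inl v) - d.dist (Sum.inr j) (Sum.inl v)) t) ≤ 1 / 2 + ε := by
  refine (hd.gainTail_le_sum D j j (by rwa [dist_candidate_self])).trans ((hD j).trans' ?_)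
  rw [shareVsLottery_eq_sum]
  refine Finset.sum_le_sum fun i _ => mul_le_mul_of_nonneg_right ?_ (P.share_nonneg _ _)
  exact mul_le_of_le_one_right (stdSimplex.zero_le D i) (step_le_one _ _)

variable [Nonempty V]

/-- The candidates of `D` outside a set do not beat those inside it by much. -/
theorem sum_mul_sum_share_le (hD : ∀ a, P.shareVsLottery a D ≤ 1 / 2 + ε) (g : C → ℝ)
    (hg : ∀ i, g i ≤ 1) :
    ∑ k, D k * (1 - g k) * ∑ i, D i * g i * P.share k i ≤
      (1 - ∑ i, D i * g i) * ((∑ i, D i * g i) / 2 + ε) := by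
  have h₁ : ∑ k, D k * (1 - g k) * ∑ i, D i * g i * P.share k i +
      ∑ k, ∑ i, D k * (1 - g k) * (D i * (1 - g i)) * P.share k i =
      ∑ k, D k * (1 - g k) * P.shareVsLottery k D := by
    rw [← Finset.sum_add_distrib]
    refine Finset.sum_congr rfl fun k _ => ?_
    rw [shareVsLottery_eq_sum, Finset.mul_sum, Finset.mul_sum, ← Finset.sum_add_distrib]
    exact Finset.sum_congr rfl fun i _ => by ring
  have h₂ : ∑ k, D k * (1 - g k) * P.shareVsLottery k D ≤
      ∑ k, D k * (1 - g k) * (1 / 2 + ε) :=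
    Finset.sum_le_sum fun k _ => mul_le_mul_of_nonneg_left (hD k)
      (mul_nonneg (stdSimplex.zero_le D k) (sub_nonneg.2 (hg k)))
  rw [← Finset.sum_mul, sum_mul_one_sub_step] at h₂
  -- Comparisons among the candidates weighted by 1 - `g` cancel in pairs and contribute exactly
  -- half of their squared mass.
  rw [P.sum_sum_mul_share fun i => D i * (1 - g i), sum_mul_one_sub_step] at h₁
  linarith

/-- Average `gainTail_le_sum` over `k` drawn from `D` conditioned on the ball of radius `t`. If `D`
has no mass there, the reference `j` suffices. -/
theorem IsConsistent.gainTail_le (hd : P.IsConsistent d)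
    (hD : ∀ a, P.shareVsLottery a D ≤ 1 / 2 + ε) (j : C) {t : ℝ} (ht : 0 ≤ t) :
    voterAvg (fun v => ∑ i, D i *
      step (d.dist (Sum.inr i) (Sum.inl v) - d.dist (Sum.inr j) (Sum.inl v)) t) ≤
      (∑ i, D i * step (d.dist (Sum.inr i) (Sum.inr j)) t) / 2 + ε := by
  set g : C → ℝ := fun i => step (d.dist (Sum.inr i) (Sum.inr j)) t with hg
  set F := voterAvg (fun v => ∑ i, D i *
      step (d.dist (Sum.inr i) (Sum.inl v) - d.dist (Sum.inr j) (Sum.inl v)) t)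
  have hg1 : ∀ i, g i ≤ 1 := fun i => step_le_one _ _
  have hρ : ∑ i, D i * g i ≤ 1 := by
    rw [← stdSimplex.sum_eq_one D]
    exact Finset.sum_le_sum fun i _ => mul_le_of_le_one_right (stdSimplex.zero_le D i) (hg1 i)
  rcases hρ.eq_or_lt with h1 | h1
  · change F ≤ (∑ i, D i * g i) / 2 + ε
    rw [h1]
    exact hd.gainTail_le_half hD j ht
  have key : (1 - ∑ i, D i * g i) * F ≤ (1 - ∑ i, D i * g i) * ((∑ i, D i * g i) / 2 + ε) := by
    refine (sum_mul_sum_share_le hD g hg1).trans' ?_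
    rw [← sum_mul_one_sub_step, Finset.sum_mul]
    refine Finset.sum_le_sum fun k _ => ?_
    by_cases hk : d.dist (Sum.inr k) (Sum.inr j) ≤ t
    · exact mul_le_mul_of_nonneg_left (hd.gainTail_le_sum D j k hk)
        (mul_nonneg (stdSimplex.zero_le D k) (sub_nonneg.2 (hg1 k)))
    · have : g k = 1 := step_of_lt (not_le.1 hk)
      simp [this]
  exact le_of_mul_le_mul_left key (by linarith)

/-- Let ρ be the mass of `D` far from `j` and b the part of it, weighted by shares, that beats `j`.
A voter ranking a far candidate above `j` is far from `j`, which bounds b above. For the lower bound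
b ≥ ρ²/2 - ε, transitivity through near candidates `k` is averaged: near candidates do not beat far
ones by much, and `j` does not beat `D` by much. -/
theorem IsConsistent.le_mul_costTail (hd : P.IsConsistent d)
    (hD : ∀ a, P.shareVsLottery a D ≤ 1 / 2 + ε) (j : C) {t : ℝ} (ht : 0 ≤ t) :
    (∑ i, D i * step (d.dist (Sum.inr i) (Sum.inr j)) t) ^ 2 / 2 - ε ≤
      (∑ i, D i * step (d.dist (Sum.inr i) (Sum.inr j)) t) *
        voterAvg (fun v => step (2 * d.dist (Sum.inr j) (Sum.inl v)) t) := by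
  set g : C → ℝ := fun i => step (d.dist (Sum.inr i) (Sum.inr j)) t with hg
  have hg0 : ∀ i, 0 ≤ g i := fun i => step_nonneg _ _
  have hg1 : ∀ i, g i ≤ 1 := fun i => step_le_one _ _
  set ρ := ∑ i, D i * g i with hρ
  set b := ∑ i, D i * g i * P.share i j with hb
  have h₁ : b ≤ ρ * voterAvg (fun v => step (2 * d.dist (Sum.inr j) (Sum.inl v)) t) := by
    rw [hb, hρ, Finset.sum_mul]
    refine Finset.sum_le_sum fun i _ => ?_
    rw [share_eq_voterAvg, mul_assoc, mul_assoc]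
    refine mul_le_mul_of_nonneg_left ?_ (stdSimplex.zero_le D i)
    have hgi : g i * g i = g i := by
      simp only [hg, step]; split_ifs <;> simp
    have h : g i * voterAvg (fun v => P.voterPref v i j) ≤
        voterAvg (fun v => step (2 * d.dist (Sum.inr j) (Sum.inl v)) t) := by
      rw [← voterAvg_const_mul]
      exact voterAvg_mono fun v => hd.step_mul_voterPref_le v i j ht
    rw [← hgi, mul_assoc, hgi]
    exact mul_le_mul_of_nonneg_left h (hg0 i)
  have hR := sum_mul_sum_share_le hD g hg1
  set R := ∑ k, D k * (1 - g k) * ∑ i, D i * g i * P.share k i with hRdef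
  have h₂ : ∑ k, D k * (1 - g k) * P.share k j = 1 - P.shareVsLottery j D - b := by
    have h1 : 1 - P.shareVsLottery j D - b = ∑ k, D k - P.shareVsLottery j D - b := by
      rw [stdSimplex.sum_eq_one]
    rw [h1, shareVsLottery_eq_sum, hb, ← Finset.sum_sub_distrib, ← Finset.sum_sub_distrib]
    refine Finset.sum_congr rfl fun k _ => ?_
    linear_combination D k * P.share_add_swap k j
  have h₃ : ∑ k, ∑ i, D k * (1 - g k) * (D i * g i) *
      (1 - P.share k i + P.share k j - 1) ≤
      ∑ k, ∑ i, D k * (1 - g k) * (D i * g i) * P.share i j := by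
    refine Finset.sum_le_sum fun k _ => Finset.sum_le_sum fun i _ => ?_
    by_cases hik : i = k
    · subst hik
      have : (1 - g i) * g i = 0 := by simp only [hg, step]; split_ifs <;> simp
      have : D i * (1 - g i) * (D i * g i) = 0 := by linear_combination D i * D i * this
      rw [this]; simp
    · refine mul_le_mul_of_nonneg_left ?_ ?_
      · linarith [P.share_triangle (j := j) hik, P.share_add_swap i k]
      · exact mul_nonneg (mul_nonneg (stdSimplex.zero_le D k) (sub_nonneg.2 (hg1 k)))
          (mul_nonneg (stdSimplex.zero_le D i) (hg0 i))
  have h₄ : ∑ k, ∑ i, D k * (1 - g k) * (D i * g i) * P.share i j = (1 - ρ) * b := by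
    rw [hρ, ← sum_mul_one_sub_step, hb, Finset.sum_mul_sum]
    exact Finset.sum_congr rfl fun k _ => Finset.sum_congr rfl fun i _ => by ring
  have h₅ : ∑ k, ∑ i, D k * (1 - g k) * (D i * g i) * (1 - P.share k i + P.share k j - 1) =
      (1 - P.shareVsLottery j D - b) * ρ - R := by
    rw [← h₂, hρ, hRdef, Finset.sum_mul_sum, ← Finset.sum_sub_distrib]
    refine Finset.sum_congr rfl fun k _ => ?_
    rw [Finset.mul_sum, ← Finset.sum_sub_distrib]
    exact Finset.sum_congr rfl fun i _ => by ring
  have hρ0 : 0 ≤ ρ := Finset.sum_nonneg fun i _ => mul_nonneg (stdSimplex.zero_le D i) (hg0 i)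
  have h₆ : (1 / 2 - ε - b) * ρ ≤ (1 - P.shareVsLottery j D - b) * ρ :=
    mul_le_mul_of_nonneg_right (by linarith [hD j]) hρ0
  rw [h₄, h₅] at h₃
  nlinarith

end Tail

end PreferenceProfile

/-! ### Cost of approximate maximal lotteries -/

namespace PreferenceProfile

variable {V C : Type*} {P : PreferenceProfile V C} {d : PseudoMetricSpace (V ⊕ C)}
  [Fintype V]

theorem socialCost_eq_voterAvg (d : PseudoMetricSpace (V ⊕ C)) (i : C) :
    socialCost d i = voterAvg fun v => d.dist (Sum.inr i) (Sum.inl v) := rfl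

theorem socialCost_nonneg (d : PseudoMetricSpace (V ⊕ C)) (i : C) : 0 ≤ socialCost d i :=
  voterAvg_nonneg fun _ => dist_candidate_nonneg d _ _

theorem voterAvg_sum_mul_cost_sub [Fintype C] (d : PseudoMetricSpace (V ⊕ C))
    (D : stdSimplex ℝ C) (j : C) :
    voterAvg (fun v => ∑ i, D i *
      (d.dist (Sum.inr i) (Sum.inl v) - d.dist (Sum.inr j) (Sum.inl v))) =
      ∑ i, D i * socialCost d i - socialCost d j := by
  rw [voterAvg_sum]
  simp_rw [voterAvg_const_mul, voterAvg_sub, ← socialCost_eq_voterAvg, mul_sub,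
    Finset.sum_sub_distrib, ← Finset.sum_mul, stdSimplex.sum_eq_one, one_mul]

variable [Nonempty V] [Fintype C]

theorem IsConsistent.gainTail_le_costTail (hd : P.IsConsistent d) {D : stdSimplex ℝ C} {e : ℝ}
    (he : 0 ≤ e) (hD : ∀ a, P.shareVsLottery a D ≤ 1 / 2 + e ^ 2) (j : C) {t : ℝ} (ht : 0 ≤ t) :
    voterAvg (fun v => ∑ i, D i *
      step (d.dist (Sum.inr i) (Sum.inl v) - d.dist (Sum.inr j) (Sum.inl v)) t) ≤
      voterAvg (fun v => step (2 * d.dist (Sum.inr j) (Sum.inl v)) t) + (e + e ^ 2) := by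
  have h₁ := hd.gainTail_le hD j ht
  have h₂ := hd.le_mul_costTail hD j ht
  have hF : 0 ≤ voterAvg (fun v => step (2 * d.dist (Sum.inr j) (Sum.inl v)) t) :=
    voterAvg_nonneg fun _ => step_nonneg _ _
  set F := voterAvg (fun v => step (2 * d.dist (Sum.inr j) (Sum.inl v)) t)
  set ρ := ∑ i, D i * step (d.dist (Sum.inr i) (Sum.inr j)) t
  refine h₁.trans ?_
  -- Dividing the bound of `le_mul_costTail` by ρ is affordable only when ρ exceeds the order of
  -- `e`; hence an error `e ^ 2` in the shares becomes one of order `e` in the tails.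
  rcases le_or_gt ρ (2 * e) with h | h
  · linarith
  · have hρ : 0 < ρ := by linarith
    have : ρ * (ρ / 2) ≤ ρ * (F + e) := by nlinarith
    linarith [le_of_mul_le_mul_left this hρ]

/-- The cost of an approximate maximal lottery, with the improvement obtained when many voters are
far away from `j`. -/
theorem IsConsistent.sum_mul_socialCost_add_le (hd : P.IsConsistent d) {D : stdSimplex ℝ C}
    {e X τ t₀ : ℝ} (he : 0 ≤ e) (hD : ∀ a, P.shareVsLottery a D ≤ 1 / 2 + e ^ 2) (j : C)
    (hX0 : 0 ≤ X) (hX : ∀ i, 0 < D i → d.dist (Sum.inr i) (Sum.inr j) ≤ X) (hτ : 0 ≤ τ)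
    (ht₀ : t₀ ≤ X) (hfar : ∀ t, 0 < t → t < t₀ →
      1 / 2 + τ ≤ voterAvg (fun v => step (2 * d.dist (Sum.inr j) (Sum.inl v)) t)) :
    ∑ i, D i * socialCost d i + τ * t₀ ≤ 3 * socialCost d j + (e + e ^ 2) * X := by
  have key := voterAvg_sum_le_of_tail_le D
    (fun v i => d.dist (Sum.inr i) (Sum.inl v) - d.dist (Sum.inr j) (Sum.inl v))
    (fun v => 2 * d.dist (Sum.inr j) (Sum.inl v)) (c := e + e ^ 2) hX0
    (fun v i hi => by linarith [hX i hi, dist_voter_le d i j v])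
    (fun v => by linarith [dist_candidate_nonneg d (Sum.inr j) (Sum.inl v)]) ht₀ hτ ?_
  · rw [voterAvg_sum_mul_cost_sub, voterAvg_const_mul, ← socialCost_eq_voterAvg] at key
    linarith
  · intro t ht
    rcases lt_or_ge t t₀ with h | h
    · rw [step_of_lt h]
      linarith [hfar t ht.1 h, hd.gainTail_le_half hD j ht.1.le]
    · rw [step_of_le h]
      linarith [hd.gainTail_le_costTail he hD j ht.1.le]

theorem IsMaximalLottery.sum_mul_socialCost_le {D : stdSimplex ℝ C} (hD : P.IsMaximalLottery D)
    (hd : P.IsConsistent d) (j : C) :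
    ∑ i, D i * socialCost d i ≤ 3 * socialCost d j := by
  have h := hd.sum_mul_socialCost_add_le (D := D) (e := 0) (τ := 0) (t₀ := 0)
    (X := ∑ i, d.dist (Sum.inr i) (Sum.inr j)) le_rfl
    (fun a => by simpa using hD.shareVsLottery_le P a) j
    (Finset.sum_nonneg fun _ _ => dist_candidate_nonneg d _ _)
    (fun i _ => Finset.single_le_sum (f := fun i => d.dist (Sum.inr i) (Sum.inr j))
      (fun _ _ => dist_candidate_nonneg d _ _) (Finset.mem_univ i)) le_rfl
    (Finset.sum_nonneg fun _ _ => dist_candidate_nonneg d _ _)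
    (fun t h0 h1 => absurd h0 h1.not_gt)
  simpa using h

/-- A voter who prefers `i` to `k` has d(i,j) ≤ d(k,v) + d(j,v). As `i` beats `D` exactly half of
the time, d(i,j)/2 is at most the sum of the costs of `D` and `j`, hence at most four times the cost
of `j`. -/
theorem IsMaximalLottery.dist_le {D : stdSimplex ℝ C} (hD : P.IsMaximalLottery D)
    (hd : P.IsConsistent d) (j : C) {i : C} (hi : 0 < D i) :
    d.dist (Sum.inr i) (Sum.inr j) ≤ 8 * socialCost d j := by
  have h₁ : voterAvg (fun v => ∑ k, D k * P.voterPref v i k) = 1 / 2 :=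
    hD.shareVsLottery_eq P hi
  have h₂ : d.dist (Sum.inr i) (Sum.inr j) * voterAvg (fun v => ∑ k, D k * P.voterPref v i k) ≤
      voterAvg fun v => ∑ k, D k *
        (d.dist (Sum.inr k) (Sum.inl v) - d.dist (Sum.inr j) (Sum.inl v)) +
        2 * d.dist (Sum.inr j) (Sum.inl v) := by
    rw [← voterAvg_const_mul]
    refine voterAvg_mono fun v => ?_
    have h2 : 2 * d.dist (Sum.inr j) (Sum.inl v) =
        ∑ k, D k * (2 * d.dist (Sum.inr j) (Sum.inl v)) := by
      rw [← Finset.sum_mul, stdSimplex.sum_eq_one, one_mul]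
    rw [h2, ← Finset.sum_add_distrib, Finset.mul_sum]
    refine Finset.sum_le_sum fun k _ => ?_
    rw [← mul_add, mul_left_comm]
    refine mul_le_mul_of_nonneg_left ?_ (stdSimplex.zero_le D k)
    have hij := dist_candidate_le d i j v
    have h0 := dist_candidate_nonneg d (Sum.inr i) (Sum.inr j)
    have h0k := dist_candidate_nonneg d (Sum.inr k) (Sum.inl v)
    have h0j := dist_candidate_nonneg d (Sum.inr j) (Sum.inl v)
    rcases P.voterPref_cases v i k with ⟨rfl, h, -⟩ | ⟨h', h, -⟩ | ⟨-, h, -⟩ <;> rw [h]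
    · linarith
    · linarith [hd v i k h']
    · linarith
  rw [h₁, voterAvg_add, voterAvg_sum_mul_cost_sub, voterAvg_const_mul,
    ← socialCost_eq_voterAvg] at h₂
  linarith [hD.sum_mul_socialCost_le hd j]

theorem IsRepApxMaximalLottery.sum_mul_socialCost_add_le {D : stdSimplex ℝ C} {e τ t₀ : ℝ}
    (he : 0 ≤ e) (he1 : e ≤ 1) (hD : P.IsRepApxMaximalLottery (e ^ 2) D) (hd : P.IsConsistent d)
    (j : C) (hτ : 0 ≤ τ) (ht₀ : t₀ ≤ 8 * socialCost d j) (hfar : ∀ t, 0 < t → t < t₀ →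
      1 / 2 + τ ≤ voterAvg (fun v => step (2 * d.dist (Sum.inr j) (Sum.inl v)) t)) :
    ∑ i, D i * socialCost d i + τ * t₀ ≤ (3 + 16 * e) * socialCost d j := by
  obtain ⟨⟨D₀, hD₀, hsupp⟩, hD⟩ := hD
  have h0 := socialCost_nonneg d j
  have := hd.sum_mul_socialCost_add_le he hD j (X := 8 * socialCost d j) (by linarith)
    (fun i hi => hD₀.dist_le hd j (hsupp i hi)) hτ ht₀ hfar
  have he2 : (e + e ^ 2) * (8 * socialCost d j) ≤ (2 * e) * (8 * socialCost d j) :=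
    mul_le_mul_of_nonneg_right (by nlinarith) (by linarith)
  linarith

theorem IsRepApxMaximalLottery.sum_mul_socialCost_le {D : stdSimplex ℝ C} {e : ℝ}
    (he : 0 ≤ e) (he1 : e ≤ 1) (hD : P.IsRepApxMaximalLottery (e ^ 2) D) (hd : P.IsConsistent d)
    (j : C) : ∑ i, D i * socialCost d i ≤ (3 + 16 * e) * socialCost d j := by
  have := hD.sum_mul_socialCost_add_le he he1 hd j (τ := 0) (t₀ := 0) le_rfl
    (by linarith [socialCost_nonneg d j]) (fun t h0 h1 => absurd h0 h1.not_gt)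
  linarith

/-- If the cost of an approximate maximal lottery is close to three times that of `j`, then almost
half of the voters are close to `j`. -/
theorem IsRepApxMaximalLottery.costTail_lt {D : stdSimplex ℝ C} {e τ t₀ : ℝ}
    (he : 0 ≤ e) (he1 : e ≤ 1) (hD : P.IsRepApxMaximalLottery (e ^ 2) D) (hd : P.IsConsistent d)
    (j : C) (hτ : 0 ≤ τ) (ht₀ : t₀ ≤ 8 * socialCost d j)
    (h : (3 + 16 * e) * socialCost d j < ∑ i, D i * socialCost d i + τ * t₀) :
    voterAvg (fun v => step (2 * d.dist (Sum.inr j) (Sum.inl v)) t₀) < 1 / 2 + τ := by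
  by_contra! H
  refine h.not_ge (hD.sum_mul_socialCost_add_le he he1 hd j hτ ht₀ fun t _ ht => H.trans ?_)
  refine voterAvg_mono fun v => ?_
  rcases lt_or_ge t₀ (2 * d.dist (Sum.inr j) (Sum.inl v)) with h | h
  · rw [step_of_lt h, step_of_lt (ht.trans h)]
  · rw [step_of_le h]; exact step_nonneg _ _

end PreferenceProfile

/-! ### Estimates for the parameter L -/

theorem log_div_self_pos {k : ℕ} (hk : 7 ≤ k) : 0 < Real.log ((k : ℝ) / 4) / k := by
  have hk' : (7 : ℝ) ≤ k := by exact_mod_cast hk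
  exact div_pos (Real.log_pos (by linarith)) (by linarith)

theorem log_div_self_le {k : ℕ} (hk : 7 ≤ k) : Real.log ((k : ℝ) / 4) / k ≤ 1 / 10 := by
  have hk' : (7 : ℝ) ≤ k := by exact_mod_cast hk
  have h₁ : Real.log (5 / 2) ≤ 1 := by
    rw [Real.log_le_iff_le_exp (by norm_num)]
    linarith [Real.exp_one_gt_d9]
  have h₂ := Real.log_le_sub_one_of_pos (x := (k : ℝ) / 10) (by linarith)
  have h₃ : Real.log ((k : ℝ) / 4) = Real.log ((k : ℝ) / 10) + Real.log (5 / 2) := by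
    rw [← Real.log_mul (by positivity) (by norm_num)]
    congr 1; ring
  rw [div_le_iff₀ (by linarith)]
  linarith

/-- A `k`-th power that is at most about `4 / k` has a base bounded away from one. -/
theorem le_of_mul_pow_le_four_div {k : ℕ} (hk : 7 ≤ k) {p L : ℝ}
    (hL : L = Real.log ((k : ℝ) / 4) / k) (hp : (1 - L / 5) * p ^ k ≤ 4 / k) :
    p ≤ 1 - 3 / 4 * L := by
  have hL0 : 0 < L := hL ▸ log_div_self_pos hk
  have hL1 : L ≤ 1 / 10 := hL ▸ log_div_self_le hk
  have hk' : (7 : ℝ) ≤ k := by exact_mod_cast hk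
  by_contra! H
  have hkL : k * L = Real.log ((k : ℝ) / 4) := by rw [hL]; field_simp
  have h₁ : Real.exp (-(9 / 10 * L)) ≤ p := by
    have h := Real.add_one_le_exp (9 / 10 * L)
    rw [Real.exp_neg]
    refine le_trans ?_ H.le
    rw [inv_le_iff_one_le_mul₀ (Real.exp_pos _)]
    have : (1 - 3 / 4 * L) * (9 / 10 * L + 1) ≤ (1 - 3 / 4 * L) * Real.exp (9 / 10 * L) :=
      mul_le_mul_of_nonneg_left h (by linarith)
    nlinarith
  -- Since exp(-kL) = 4/k, lowering the rate from 1 to 9/10 leaves a surplus exp(kL/10) ≥ 1 + 7L/10,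
  -- using k ≥ 7; this outweighs the factor 1 - L/5.
  have h₂ : Real.exp (-(9 / 10 * L)) ^ k = 4 / k * Real.exp (k * L / 10) := by
    rw [← Real.exp_nat_mul]
    have : (k : ℝ) * -(9 / 10 * L) = -(k * L) + k * L / 10 := by ring
    rw [this, Real.exp_add, hkL, Real.exp_neg, Real.exp_log (by positivity), inv_div]
  have h₃ : 4 / k * (1 + 7 / 10 * L) ≤ p ^ k := by
    refine le_trans ?_ (pow_le_pow_left₀ (Real.exp_pos _).le h₁ k)
    rw [h₂]
    refine mul_le_mul_of_nonneg_left ?_ (by positivity)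
    have := Real.add_one_le_exp ((k : ℝ) * L / 10)
    nlinarith
  have h₄ : (1 - L / 5) * (4 / k * (1 + 7 / 10 * L)) ≤ 4 / k :=
    (mul_le_mul_of_nonneg_left h₃ (by linarith)).trans hp
  have h4k : (0 : ℝ) < 4 / k := by positivity
  have h₅ : (1 - L / 5) * (1 + 7 / 10 * L) ≤ 1 := by
    refine le_of_mul_le_mul_left ?_ h4k
    linarith
  nlinarith

/-! ### Cost of pruned lotteries -/

namespace PreferenceProfile

section TwoCandidates

variable {V C : Type*} {P : PreferenceProfile V C} {d : PseudoMetricSpace (V ⊕ C)}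
  [Fintype V]

/-- If most voters are near `j`, a candidate that beats `w` by a sufficient margin beats `w`
for some voter near `j`. -/
theorem exists_near_prefers {β τ h : ℝ} {u w j : C}
    (hnear : voterAvg (fun v => step (2 * d.dist (Sum.inr j) (Sum.inl v)) (2 * h)) < 1 / 2 + τ)
    (hτ : τ ≤ β) (huw : (P.thresholdGraph (1 / 2 + β)).Adj u w) :
    ∃ v, d.dist (Sum.inr j) (Sum.inl v) ≤ h ∧ P.prefers v u w := by
  have h₁ : voterAvg (fun v => step (2 * d.dist (Sum.inr j) (Sum.inl v)) (2 * h)) <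
      voterAvg fun v => P.voterPref v u w :=
    hnear.trans_le (by have := huw.2; rw [share_eq_voterAvg] at this; linarith)
  obtain ⟨v, hv⟩ := exists_of_voterAvg_lt h₁
  refine ⟨v, ?_, ?_⟩
  · by_contra! H
    rw [step_of_lt (by linarith)] at hv
    exact absurd (P.voterPref_le_one v u w) (not_le.2 hv)
  · refine (P.prefers_or_of_ne v huw.1).resolve_right fun H => ?_
    rw [P.voterPref_of_prefers_swap H] at hv
    exact absurd (step_nonneg _ _) (not_le.2 hv)

theorem IsConsistent.dist_le_of_near (hd : P.IsConsistent d) {β τ h r : ℝ} {u w j : C}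
    (hnear : voterAvg (fun v => step (2 * d.dist (Sum.inr j) (Sum.inl v)) (2 * h)) < 1 / 2 + τ)
    (hτ : τ ≤ β) (huw : (P.thresholdGraph (1 / 2 + β)).Adj u w)
    (hw : d.dist (Sum.inr w) (Sum.inr j) ≤ r) :
    d.dist (Sum.inr u) (Sum.inr j) ≤ r + 2 * h := by
  obtain ⟨v, hv, hp⟩ := exists_near_prefers hnear hτ huw
  linarith [hd v u w hp, dist_candidate_le d u j v, dist_voter_le d w j v]

/-- Each edge of a path from the quasi-kernel to `j` adds at most 2`h` to the distance, and two
edges suffice. -/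
theorem IsConsistent.exists_mem_quasiKernel_near (hd : P.IsConsistent d) {β τ h : ℝ} {j : C}
    {S : Finset C} (hh : 0 ≤ h)
    (hnear : voterAvg (fun v => step (2 * d.dist (Sum.inr j) (Sum.inl v)) (2 * h)) < 1 / 2 + τ)
    (hτ : τ ≤ β) (hS : (P.thresholdGraph (1 / 2 + β)).IsQuasiKernel S) :
    ∃ u ∈ S, d.dist (Sum.inr u) (Sum.inr j) ≤ 4 * h := by
  have hj := (dist_candidate_self d j).le
  by_cases hjS : j ∈ S
  · exact ⟨j, hjS, by linarith⟩
  obtain ⟨u, hu, huj | ⟨w, huw, hwj⟩⟩ := hS.2 j hjS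
  · exact ⟨u, hu, by linarith [hd.dist_le_of_near hnear hτ huj hj]⟩
  · exact ⟨u, hu, by linarith [hd.dist_le_of_near hnear hτ huw (hd.dist_le_of_near hnear hτ hwj hj)]⟩

variable [Nonempty V]

/-- A candidate that is not beaten badly by some candidate near `j` costs little more than `j`. -/
theorem IsConsistent.socialCost_le (hd : P.IsConsistent d) {i u j : C} {s r : ℝ} (hs : 0 < s)
    (hsi : s ≤ P.share i u) (hr : d.dist (Sum.inr u) (Sum.inr j) ≤ r) :
    socialCost d i ≤ (2 / s - 1) * socialCost d j + r := by
  -- Voters preferring `u` to `i` pay at most `z` extra for `i`, whereas those preferring `i` to `u`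
  -- satisfy `z` ≤ 2d(j,v); a large share of the latter therefore makes `z` small.
  set z := max (d.dist (Sum.inr i) (Sum.inr j) - r) 0
  have hz0 : 0 ≤ z := le_max_right _ _
  have hz : d.dist (Sum.inr i) (Sum.inr j) - r ≤ z := le_max_left _ _
  have h₁ : socialCost d i ≤ socialCost d j + r + (1 - P.share i u) * z := by
    have h : socialCost d i ≤ voterAvg fun v =>
        d.dist (Sum.inr j) (Sum.inl v) + (r + (1 - P.voterPref v i u) * z) := by
      refine voterAvg_mono fun v => ?_
      have hij := dist_voter_le d i j v
      have huj := dist_voter_le d u j v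
      rcases P.voterPref_cases v i u with ⟨rfl, h, -⟩ | ⟨h', h, -⟩ | ⟨-, h, -⟩ <;> rw [h]
      · linarith
      · linarith [hd v i u h']
      · linarith
    rw [voterAvg_add, voterAvg_add, voterAvg_const, voterAvg_mul_const, voterAvg_sub,
      voterAvg_const] at h
    rw [share_eq_voterAvg, socialCost_eq_voterAvg d j]
    linarith
  have h₂ : P.share i u * z ≤ 2 * socialCost d j := by
    rw [share_eq_voterAvg, socialCost_eq_voterAvg, ← voterAvg_mul_const, ← voterAvg_const_mul]
    refine voterAvg_mono fun v => ?_
    have hij := dist_candidate_le d i j v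
    have huj := dist_voter_le d u j v
    have h0 := dist_candidate_nonneg d (Sum.inr j) (Sum.inl v)
    rcases P.voterPref_cases v i u with ⟨rfl, h, -⟩ | ⟨h', h, -⟩ | ⟨-, h, -⟩ <;> rw [h]
    · have : z = 0 := max_eq_right (by linarith)
      rw [this]; linarith
    · rw [one_mul]
      refine max_le ?_ (by linarith)
      linarith [hd v i u h']
    · linarith
  have h₃ : z ≤ 2 * socialCost d j / s := by
    rw [le_div_iff₀ hs, mul_comm]
    exact (mul_le_mul_of_nonneg_right hsi hz0).trans h₂
  have h₄ : (1 - P.share i u) * z ≤ (1 - s) * (2 * socialCost d j / s) :=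
    mul_le_mul (by linarith) h₃ hz0 (by linarith [P.share_le_one i u])
  have h₅ : (1 - s) * (2 * socialCost d j / s) = (2 / s - 1) * socialCost d j - socialCost d j := by
    field_simp; ring
  linarith

theorem IsConsistent.socialCost_le_of_share (hd : P.IsConsistent d) {i j : C} {s : ℝ} (hs : 0 < s)
    (hsi : s ≤ P.share i j) : socialCost d i ≤ (2 / s - 1) * socialCost d j := by
  simpa using hd.socialCost_le hs hsi (dist_candidate_self d j).le

/-- Each edge multiplies the cost by at most 3. This crude bound needs no voters near `j`. -/
theorem IsConsistent.exists_mem_quasiKernel_socialCost_le (hd : P.IsConsistent d) {β : ℝ}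
    (hβ : 0 ≤ β) {S : Finset C} (hS : (P.thresholdGraph (1 / 2 + β)).IsQuasiKernel S) (j : C) :
    ∃ u ∈ S, socialCost d u ≤ 9 * socialCost d j := by
  have h0 := socialCost_nonneg d j
  have edge : ∀ {a b}, (P.thresholdGraph (1 / 2 + β)).Adj a b →
      socialCost d a ≤ 3 * socialCost d b := fun {a b} hab => by
    have h := hd.socialCost_le_of_share (i := a) (j := b) (s := 1 / 2) (by norm_num)
      (by linarith [hab.2])
    norm_num at h
    exact h
  by_cases hjS : j ∈ S
  · exact ⟨j, hjS, by linarith⟩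
  obtain ⟨u, hu, huj | ⟨w, huw, hwj⟩⟩ := hS.2 j hjS
  · exact ⟨u, hu, by linarith [edge huj]⟩
  · exact ⟨u, hu, by linarith [edge huw, edge hwj]⟩

theorem share_ge_of_isQuasiKernel {β : ℝ} (hβ : 0 ≤ β) {S : Finset C}
    (hS : (P.thresholdGraph (1 / 2 + β)).IsQuasiKernel S) {i u : C} (hi : i ∈ S) (hu : u ∈ S) :
    1 / 2 - β ≤ P.share i u := by
  by_cases h : i = u
  · subst h
    linarith [P.share_add_swap i i]
  · have : P.share u i < 1 / 2 + β := by
      by_contra! H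
      exact hS.1 u hu i hi (Ne.symm h) ⟨Ne.symm h, H⟩
    linarith [P.share_add_swap i u]

end TwoCandidates

variable {V C : Type*} {P : PreferenceProfile V C} {d : PseudoMetricSpace (V ⊕ C)}
  [Fintype V]

/-- If a candidate is preferred by a set of voters to all candidates in a set, it beats a sample
from a lottery at least when the whole sample lies in this set. -/
theorem mul_pow_le_beatsSample [Fintype C] (E : stdSimplex ℝ C) (k : ℕ) (u : C) (g : C → ℝ)
    (hg0 : ∀ c, 0 ≤ g c) (hg1 : ∀ c, g c ≤ 1) (q : V → ℝ) (hq0 : ∀ v, 0 ≤ q v) (hq1 : ∀ v, q v ≤ 1)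
    (h : ∀ v, 0 < q v → ∀ c, 0 < g c → P.prefers v u c) :
    voterAvg q * (∑ c, E c * g c) ^ k ≤ P.beatsSample k u E := by
  rw [beatsSample_eq_integral, ← voterAvg_mul_const]
  refine voterAvg_mono fun v => ?_
  have hc := fun c => P.continuous_tieWeight v u c
  have hp0 : 0 ≤ ∑ c, E c * g c :=
    Finset.sum_nonneg fun c _ => mul_nonneg (stdSimplex.zero_le E c) (hg0 c)
  have hconst : q v * (∑ c, E c * g c) ^ k =
      ∫ _ in (0 : ℝ)..1, q v * (∑ c, E c * g c) ^ k := by simp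
  rw [hconst]
  refine intervalIntegral.integral_mono_on zero_le_one intervalIntegrable_const
    (Continuous.intervalIntegrable (by fun_prop) _ _) fun r hr => ?_
  rcases (hq0 v).eq_or_lt with hv | hv
  · rw [← hv, zero_mul]
    exact pow_nonneg (Finset.sum_nonneg fun c _ => mul_nonneg (stdSimplex.zero_le E c)
      (P.tieWeight_nonneg v u hr.1 c)) k
  · refine (mul_le_of_le_one_left (pow_nonneg hp0 k) (hq1 v)).trans ?_
    refine pow_le_pow_left₀ hp0 (Finset.sum_le_sum fun c _ =>
      mul_le_mul_of_nonneg_left ?_ (stdSimplex.zero_le E c)) k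
    rcases (hg0 c).eq_or_lt with h0 | h0
    · rw [← h0]; exact P.tieWeight_nonneg v u hr.1 c
    · have huc := h v hv c h0
      have hne : c ≠ u := by rintro rfl; exact P.not_prefers_self v c huc
      simp [tieWeight, hne, huc, hg1 c]

theorem sum_mul_eq_of_extends [Fintype C] {S : Finset C} {D : stdSimplex ℝ C}
    {E : stdSimplex ℝ {c : C // c ∈ S}} (h₁ : ∀ c : {c : C // c ∈ S}, D c.1 = E c)
    (h₂ : ∀ c ∉ S, D c = 0) (f : C → ℝ) : ∑ c, D c * f c = ∑ c, E c * f c.1 := by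
  rw [← Finset.sum_subset (Finset.subset_univ S) fun c _ hc => by rw [h₂ c hc, zero_mul],
    ← Finset.sum_coe_sort]
  exact Finset.sum_congr rfl fun c _ => by rw [h₁ c]

variable [Nonempty V]

/-- The distortion of pruned lotteries is bounded. -/
theorem IsRepApxPrunedLottery.sum_mul_socialCost_le [Fintype C] {D : stdSimplex ℝ C} {ε β : ℝ}
    {k : ℕ} (hβ : 0 ≤ β) (hβ' : β < 1 / 2) (hD : P.IsRepApxPrunedLottery ε k (1 / 2 + β) D)
    (hd : P.IsConsistent d) (j : C) :
    ∑ i, D i * socialCost d i ≤ (2 / (1 / 2 - β) - 1) * 9 * socialCost d j := by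
  obtain ⟨S, hS, E, -, h₁, h₂⟩ := hD
  obtain ⟨u, hu, hcost⟩ := hd.exists_mem_quasiKernel_socialCost_le hβ hS j
  have hs : 0 < 1 / 2 - β := by linarith
  have hs2 : 0 ≤ 2 / (1 / 2 - β) - 1 := by
    rw [sub_nonneg, le_div_iff₀ hs]; linarith
  rw [sum_mul_eq_of_extends h₁ h₂]
  calc ∑ c, E c * socialCost d c.1
      ≤ ∑ c, E c * ((2 / (1 / 2 - β) - 1) * (9 * socialCost d j)) := by
        refine Finset.sum_le_sum fun c _ => mul_le_mul_of_nonneg_left ?_ (stdSimplex.zero_le E c)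
        exact (hd.socialCost_le_of_share hs (share_ge_of_isQuasiKernel hβ hS c.2 hu)).trans
          (mul_le_mul_of_nonneg_left hcost hs2)
    _ = _ := by rw [← Finset.sum_mul, stdSimplex.sum_eq_one]; ring

/-- If almost half of the voters are near `j`, a pruned lottery selects a candidate near `j` with
noticeable probability, and no candidate in its support is much worse than three times `j`. -/
theorem IsRepApxPrunedLottery.exists_sum_mul_socialCost_le_of_near [Fintype C]
    {D : stdSimplex ℝ C} {ε β τ h : ℝ} {k : ℕ} (hτ : τ ≤ β) (hβ : 0 ≤ β) (hβ' : β < 1 / 2)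
    (hD : P.IsRepApxPrunedLottery ε k (1 / 2 + β) D) (hd : P.IsConsistent d) (j : C) (hh : 0 ≤ h)
    (hnear : voterAvg (fun v => step (2 * d.dist (Sum.inr j) (Sum.inl v)) (2 * h)) < 1 / 2 + τ) :
    ∃ p, 0 ≤ p ∧ (1 / 2 - τ) * p ^ k ≤ 1 / ((k : ℝ) + 1) + ε ∧
      ∑ i, D i * socialCost d i ≤
        p * ((2 / (1 / 2 - β) - 1) * socialCost d j + 4 * h) +
          (1 - p) * (socialCost d j + 6 * h) := by
  obtain ⟨S, hS, E, hE, h₁, h₂⟩ := hD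
  obtain ⟨u, hu, huj⟩ := hd.exists_mem_quasiKernel_near hh hnear hτ hS
  -- A voter within `h` of `j` is within 5`h` of `u` and farther than 5`h` from anything beyond
  -- radius 6`h`, so it prefers `u` to every candidate marked by `g`.
  set g : {c : C // c ∈ S} → ℝ := fun c => step (d.dist (Sum.inr c.1) (Sum.inr j)) (6 * h) with hg
  have hg0 : ∀ c, 0 ≤ g c := fun _ => step_nonneg _ _
  have hg1 : ∀ c, g c ≤ 1 := fun _ => step_le_one _ _
  have hp : 0 ≤ ∑ c, E c * g c :=
    Finset.sum_nonneg fun c _ => mul_nonneg (stdSimplex.zero_le E c) (hg0 c)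
  refine ⟨∑ c, E c * g c, hp, ?_, ?_⟩
  · have hb := mul_pow_le_beatsSample (P := P.restrict S) E k ⟨u, hu⟩ g hg0 hg1
      (fun v => 1 - step (2 * d.dist (Sum.inr j) (Sum.inl v)) (2 * h))
      (fun v => sub_nonneg.2 (step_le_one _ _)) (fun v => sub_le_self _ (step_nonneg _ _)) ?_
    · refine (mul_le_mul_of_nonneg_right ?_ (pow_nonneg hp k)).trans (hb.trans (hE.2 ⟨u, hu⟩))
      rw [voterAvg_sub, voterAvg_const]
      linarith
    · intro v hv c hc
      have hvj : d.dist (Sum.inr j) (Sum.inl v) ≤ h := by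
        by_contra! H
        rw [step_of_lt (by linarith)] at hv
        linarith
      have hcj : 6 * h < d.dist (Sum.inr c.1) (Sum.inr j) := by
        by_contra! H
        rw [hg] at hc
        exact hc.ne' (step_of_le H)
      change P.prefers v u c.1
      have hlt : d.dist (Sum.inr u) (Sum.inl v) < d.dist (Sum.inr c.1) (Sum.inl v) := by
        linarith [dist_voter_le d u j v, dist_candidate_le d c.1 j v]
      have hne : u ≠ c.1 := by
        intro heq
        rw [heq] at hlt
        exact lt_irrefl _ hlt
      exact (P.prefers_or_of_ne v hne).resolve_right fun H => (hd v _ _ H).not_gt hlt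
  · rw [sum_mul_eq_of_extends h₁ h₂, ← sum_mul_one_sub_step, Finset.sum_mul, Finset.sum_mul,
      ← Finset.sum_add_distrib]
    refine Finset.sum_le_sum fun c _ => ?_
    rw [mul_assoc, mul_assoc, ← mul_add]
    refine mul_le_mul_of_nonneg_left ?_ (stdSimplex.zero_le E c)
    rcases lt_or_ge (6 * h) (d.dist (Sum.inr c.1) (Sum.inr j)) with hc | hc
    · have : g c = 1 := step_of_lt hc
      rw [this]
      have := hd.socialCost_le (by linarith) (share_ge_of_isQuasiKernel hβ hS c.2 hu) huj
      linarith
    · have : g c = 0 := step_of_le hc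
      rw [this]
      have : socialCost d c.1 ≤ voterAvg fun v => d.dist (Sum.inr j) (Sum.inl v) + 6 * h :=
        voterAvg_mono fun v => by linarith [dist_voter_le d c.1 j v]
      rw [voterAvg_add, voterAvg_const, ← socialCost_eq_voterAvg] at this
      linarith

end PreferenceProfile

/-! ### Choice of constants and the mixture -/

section Parameters

variable {V C : Type*} {P : PreferenceProfile V C} {d : PseudoMetricSpace (V ⊕ C)}
  [Fintype V] [Nonempty V] [Fintype C] {k : ℕ} {L : ℝ} {D₁ D₂ : stdSimplex ℝ C}

theorem two_div_half_sub_le (hL0 : 0 < L) (hL1 : L ≤ 1 / 10) :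
    2 / (1 / 2 - L / 9) - 1 ≤ 3 + 91 / 100 * L := by
  rw [sub_le_iff_le_add, div_le_iff₀ (by linarith)]
  nlinarith

/-- Either the maximal lottery costs noticeably less than three times `j`, or the pruned lottery
does. -/
theorem maximal_or_pruned_cost_le (hk : 7 ≤ k) (hL : L = Real.log ((k : ℝ) / 4) / k)
    (h₁ : P.IsRepApxMaximalLottery ((L ^ 3 / 150000) ^ 2) D₁)
    (h₂ : P.IsRepApxPrunedLottery (1 / k) k (1 / 2 + L / 9) D₂) (hd : P.IsConsistent d) (j : C) :
    ∑ i, D₁ i * socialCost d i ≤ (3 - 13 / 1000 * L ^ 2) * socialCost d j ∨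
      ∑ i, D₂ i * socialCost d i ≤ (3 - 32 / 100 * L) * socialCost d j := by
  have hL0 : 0 < L := hL ▸ log_div_self_pos hk
  have hL1 : L ≤ 1 / 10 := hL ▸ log_div_self_le hk
  have hk' : (7 : ℝ) ≤ k := by exact_mod_cast hk
  have h0 := PreferenceProfile.socialCost_nonneg d j
  set S := socialCost d j
  refine or_iff_not_imp_left.2 fun hlarge => ?_
  rw [not_le] at hlarge
  have hL3 : L ^ 3 ≤ L ^ 2 / 10 := by nlinarith [sq_nonneg L]
  have hL3' : 0 ≤ L ^ 3 := by positivity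
  have hL2 : L ^ 2 ≤ 1 / 100 := by nlinarith
  -- Here τt₀ = 0.01302L²S, just above the assumed deficit 0.013L²S; the difference absorbs the
  -- approximation error 16`e`S.
  have hnear := h₁.costTail_lt (e := L ^ 3 / 150000) (τ := L / 10)
    (t₀ := 2 * (651 / 10000 * L * S)) (by positivity) (by linarith) hd j (by positivity)
    (by nlinarith) (by
      refine lt_of_le_of_lt ?_ (add_lt_add_left hlarge _)
      have : (3 + 16 * (L ^ 3 / 150000)) * S ≤
          (3 - 13 / 1000 * L ^ 2 + L / 10 * (2 * (651 / 10000 * L))) * S :=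
        mul_le_mul_of_nonneg_right (by nlinarith) h0
      linarith)
  obtain ⟨p, hp0, hp, hcost⟩ := h₂.exists_sum_mul_socialCost_le_of_near (τ := L / 10)
    (h := 651 / 10000 * L * S) (by linarith) (by linarith) (by linarith) hd j (by positivity) hnear
  have hp1 : p ≤ 1 - 3 / 4 * L := by
    refine le_of_mul_pow_le_four_div hk hL ?_
    -- The stability bound is at most 2/k; doubling it turns 1/2 - L/10 into 1 - L/5 and 2/k into
    -- 4/k.
    have h1k : 1 / ((k : ℝ) + 1) ≤ 1 / k := one_div_le_one_div_of_le (by linarith) (by linarith)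
    have h4k : (4 : ℝ) / k = 4 * (1 / k) := by ring
    rw [h4k]
    nlinarith
  have hfar : (2 / (1 / 2 - L / 9) - 1) * S ≤ (3 + 91 / 100 * L) * S :=
    mul_le_mul_of_nonneg_right (two_div_half_sub_le hL0 hL1) h0
  have hbound : p * ((2 / (1 / 2 - L / 9) - 1) * S + 4 * (651 / 10000 * L * S)) +
      (1 - p) * (S + 6 * (651 / 10000 * L * S)) ≤
      (p * (3 + 91 / 100 * L + 2604 / 10000 * L) + (1 - p) * (1 + 3906 / 10000 * L)) * S := by
    nlinarith [mul_le_mul_of_nonneg_left hfar hp0]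
  refine (hcost.trans hbound).trans (mul_le_mul_of_nonneg_right ?_ h0)
  -- The bound is increasing in `p`. At p = 1 - 3L/4 its linear term in L is 0.3906 + 0.7798 - 1.5 =
  -- -0.3296.
  have := mul_le_mul_of_nonneg_right hp1 (by linarith : 0 ≤ 2 + 7798 / 10000 * L)
  nlinarith

/-- The weight m = L²/2000 of the pruned lottery balances two cases. If the maximal lottery is good,
its saving 0.013L² covers the loss 25m = 0.0125L². If the pruned lottery is good, its saving 0.32Lm
= 0.00016L³ covers the error 16e < 0.00011L³. -/
theorem exists_mixing_bound (hk : 7 ≤ k) (hL : L = Real.log ((k : ℝ) / 4) / k) :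
    ∃ c : ℝ, 1 ≤ c ∧ c < 3 ∧ ∀ f : VotingRule.{u, v},
      f.IsMixingRule (1 - L ^ 2 / 2000) (L / 9) (L ^ 3 / 150000) (1 / k) k →
        f.DistortionAtMost c := by
  have hL0 : 0 < L := hL ▸ log_div_self_pos hk
  have hL1 : L ≤ 1 / 10 := hL ▸ log_div_self_le hk
  have hL2 : 0 < L ^ 2 := by positivity
  have hL2' : L ^ 2 ≤ 1 / 100 := by nlinarith
  have hL3 : 0 < L ^ 3 := by positivity
  have hL3' : L ^ 3 = L * L ^ 2 := by ring
  have hL3'' : L ^ 3 ≤ 1 / 100 := by rw [hL3']; nlinarith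
  set m := L ^ 2 / 2000 with hm
  have hm0 : 0 < m := by positivity
  have hm1 : m < 1 / 2 := by linarith
  set e := L ^ 3 / 150000 with he
  have he0 : 0 < e := by positivity
  have he1 : e ≤ 1 := by linarith
  refine ⟨max 1 (max ((1 - m) * (3 - 13 / 1000 * L ^ 2) + m * 28)
    ((1 - m) * (3 + 16 * e) + m * (3 - 32 / 100 * L))), le_max_left _ _,
    max_lt (by norm_num) (max_lt ?_ ?_), ?_⟩
  · nlinarith
  · nlinarith
  intro f hf V C _ _ _ _ P d hd j
  obtain ⟨D₁, D₂, h₁, h₂, hfP⟩ := hf V C P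
  have h0 := PreferenceProfile.socialCost_nonneg d j
  have hsum : ∑ i, f V C P i * socialCost d i =
      (1 - m) * ∑ i, D₁ i * socialCost d i + m * ∑ i, D₂ i * socialCost d i := by
    rw [Finset.mul_sum, Finset.mul_sum, ← Finset.sum_add_distrib]
    exact Finset.sum_congr rfl fun i _ => by rw [hfP]; ring
  rw [hsum]
  have hmax {a b c s : ℝ} (hs : 0 ≤ s) (h : a ≤ b * s) (hbc : b ≤ c) : a ≤ c * s :=
    h.trans (mul_le_mul_of_nonneg_right hbc hs)
  rcases maximal_or_pruned_cost_le hk hL h₁ h₂ hd j with h | h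
  · refine hmax h0 (b := (1 - m) * (3 - 13 / 1000 * L ^ 2) + m * 28) ?_
      ((le_max_left _ _).trans (le_max_right _ _))
    -- Since L ≤ 1/10, the crude factor is at most 9 · 3.091 < 28.
    have h28 : ∑ i, D₂ i * socialCost d i ≤ 28 * socialCost d j := by
      refine hmax h0 (h₂.sum_mul_socialCost_le (by linarith) (by linarith) hd j) ?_
      linarith [two_div_half_sub_le hL0 hL1]
    have ha := mul_le_mul_of_nonneg_left h (by linarith : 0 ≤ 1 - m)
    have hb := mul_le_mul_of_nonneg_left h28 hm0.le
    linarith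
  · refine hmax h0 (b := (1 - m) * (3 + 16 * e) + m * (3 - 32 / 100 * L)) ?_
      ((le_max_right _ _).trans (le_max_right _ _))
    have ha := mul_le_mul_of_nonneg_left (h₁.sum_mul_socialCost_le he0.le he1 hd j)
      (by linarith : 0 ≤ 1 - m)
    have hb := mul_le_mul_of_nonneg_left h hm0.le
    linarith

end Parameters

theorem VotingRule.DistortionAtMost.metricDistortion_le {f : VotingRule.{u, v}} {c : ℝ}
    (hc : 1 ≤ c) (hf : f.DistortionAtMost c) : f.metricDistortion ≤ (c : EReal) :=
  sInf_le ⟨c, hc, hf, rfl⟩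

theorem mixing_parameters_valid (k : ℕ) (L μ β ε₁ ε₂ : ℝ) (hk : 7 ≤ k)
    (hL : L = Real.log ((k : ℝ) / 4) / (k : ℝ)) (hβ : β = L / 9) (hε₁ : ε₁ = L ^ 3 / 150000)
    (hε₂ : ε₂ = 1 / (k : ℝ)) (hμ : μ = 1 - L ^ 2 / 2000) :
    μ ∈ Set.Ioo (0 : ℝ) 1 ∧ β ∈ Set.Ioo (0 : ℝ) 1 ∧ ε₁ ∈ Set.Ioo (0 : ℝ) 1 ∧
      ε₂ ∈ Set.Ioo (0 : ℝ) 1 ∧ 1 / 2 + β ≤ 1 ∧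
      (∃ f : VotingRule.{u, v}, f.IsMixingRule μ β ε₁ ε₂ k) ∧
      ∃ c : ℝ, c < 3 ∧ ∀ f : VotingRule.{u, v}, f.IsMixingRule μ β ε₁ ε₂ k →
        f.metricDistortion ≤ (c : EReal) := by
  have hL0 : 0 < L := hL ▸ log_div_self_pos hk
  have hL1 : L ≤ 1 / 10 := hL ▸ log_div_self_le hk
  have hk' : (7 : ℝ) ≤ k := by exact_mod_cast hk
  have hL2 : L ^ 2 < 1 := pow_lt_one₀ hL0.le (by linarith) (by norm_num)
  have hL3 : L ^ 3 < 1 := pow_lt_one₀ hL0.le (by linarith) (by norm_num)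
  have hL2' : 0 < L ^ 2 := by positivity
  have hL3' : 0 < L ^ 3 := by positivity
  have hμ01 : μ ∈ Set.Ioo (0 : ℝ) 1 := by rw [hμ]; constructor <;> linarith
  have hε₂01 : ε₂ ∈ Set.Ioo (0 : ℝ) 1 := by
    rw [hε₂]
    exact ⟨by positivity, (div_lt_one (by linarith)).2 (by linarith)⟩
  refine ⟨hμ01, by rw [hβ]; constructor <;> linarith, by rw [hε₁]; constructor <;> linarith,
    hε₂01, by linarith, exists_isMixingRule k ⟨hμ01.1.le, hμ01.2.le⟩ hε₂01.1.le, ?_⟩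
  obtain ⟨c, hc1, hc3, hc⟩ := exists_mixing_bound.{u, v} hk hL
  subst hβ hε₁ hε₂ hμ
  exact ⟨c, hc3, fun f hf => (hc f hf).metricDistortion_le hc1⟩

theorem mainTheorem4 :
    (∃ (μ β ε₁ ε₂ : ℝ) (k : ℕ), μ ∈ Set.Ioo (0 : ℝ) 1 ∧ β ∈ Set.Ioo (0 : ℝ) 1 ∧
      ε₁ ∈ Set.Ioo (0 : ℝ) 1 ∧ ε₂ ∈ Set.Ioo (0 : ℝ) 1 ∧ 1 ≤ k ∧ 1 / 2 + β ≤ 1 ∧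
      (∃ f : VotingRule.{u, v}, f.IsMixingRule μ β ε₁ ε₂ k) ∧
      ∃ c : ℝ, c < 3 ∧ ∀ f : VotingRule.{u, v}, f.IsMixingRule μ β ε₁ ε₂ k →
        f.metricDistortion ≤ (c : EReal)) ∧
    ∀ (k : ℕ) (L μ β ε₁ ε₂ : ℝ), 7 ≤ k → L = Real.log ((k : ℝ) / 4) / (k : ℝ) →
      β = L / 9 → ε₁ = L ^ 3 / 150000 → ε₂ = 1 / (k : ℝ) → μ = 1 - L ^ 2 / 2000 →
      μ ∈ Set.Ioo (0 : ℝ) 1 ∧ β ∈ Set.Ioo (0 : ℝ) 1 ∧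
      ε₁ ∈ Set.Ioo (0 : ℝ) 1 ∧ ε₂ ∈ Set.Ioo (0 : ℝ) 1 ∧ 1 / 2 + β ≤ 1 ∧
      (∃ f : VotingRule.{u, v}, f.IsMixingRule μ β ε₁ ε₂ k) ∧
      ∃ c : ℝ, c < 3 ∧ ∀ f : VotingRule.{u, v}, f.IsMixingRule μ β ε₁ ε₂ k →
        f.metricDistortion ≤ (c : EReal) := by
  have h := mixing_parameters_valid.{u, v}
  refine ⟨?_, h⟩
  obtain ⟨hμ, hβ, hε₁, hε₂, hβ', hf, hc⟩ := h 7 _ _ _ _ _ le_rfl rfl rfl rfl rfl rfl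
  exact ⟨_, _, _, _, 7, hμ, hβ, hε₁, hε₂, by norm_num, hβ', hf, hc⟩
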